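/- Let $(X,d)$ be a finite metric space with $n=|X|$, let $k\ge 1$ and $1\le z<n$ be integers, $\epsilon>0$, $\eta\in(0,1)$ and $\gamma=z/n$. For $A\subseteq X$ and $\epsilon'\ge 0$ let $$\phi_{\epsilon'}(X,A)=\min\Big\{\max_{p\in X'}\min_{c\in A}d(p,c)\;:\;X'\subseteq X,\ |X'|\ge n-(1+\epsilon')z\Big\},$$ and let $r_{opt}=\min_{c_1,\dots,c_k\in X}\phi_0(X,\{c_1,\dots,c_k\})$ be the optimal radius of $k$-center clustering with $z$ outliers. Let $X_{opt}\subseteq X$ with $|X_{opt}|=n-z$ be the set of inliers of an optimal solution whose $k$ centers are inliers, and assume that the metric space $(X_{opt},d)$ has doubling dimension at most $\rho>0$: for all $p\in X_{opt}$ and $r\ge 0$, the ball $X_{opt}\cap Ball(p,2r)$ is covered by at most $2^\rho$ balls of $(X_{opt},d)$ of radius $r$. Consider the following randomized algorithm with a parameter $t\ge 1$. Put into $E$ a sample of $\big\lceil\frac{1}{1-\gamma}\log\frac1\eta\big\rceil$ independent uniformly random vertices of $X$. Then, for $j=2,\dots,t$, let $Q_j$ be the set of the $\lceil(1+\epsilon)z\rceil$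 vertices of $X$ farthest from $E$ (all of $X$ if there are fewer; ties are broken arbitrarily), and add to $E$ a sample of $\big\lceil\frac{1+\epsilon}{\epsilon}\log\frac1\eta\big\rceil$ independent uniformly random vertices of $Q_j$. Output $E$. Run it with $t=\Big\lceil\frac{2^\rho k+2^{\rho/2}\sqrt k}{1-\eta}\Big\rceil$. Then: 1. With probability at least $(1-\eta)\big(1-e^{-\frac{1-\eta}{4}}\big)$, $\phi_\epsilon(X,E)\le r_{opt}$. 2. Let $\eta\in(0,1)$, $\epsilon_0$ and $\gamma_0<1$ be fixed. There is a constant $C$ depending only on $\eta,\epsilon_0,\gamma_0$ such that, whenever $\epsilon\le\epsilon_0$ and $\gamma\le\gamma_0$, with probability at least $(1-\eta)\big(1-e^{-\frac{1-\eta}{4}}\big)$ the set $E$ is a $\big(1,C\frac{2^\rho}{\epsilon}\big)$-approximation for $(k,z)_\epsilon$-center clustering, that is, $|E|\le C\frac{2^\rho}{\epsilon}k$ and $\phi_\epsilon(X,E)\le r_{opt}$; and the algorithm, implemented with a linear-time (median-of-medians) selection of the farthest vertices and given the numbers of samples, of farthest vertices and of rounds, always runs in at most $C\,2^\rho\frac{k}{\epsilon}n$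 steps, where a distance lookup, a comparison, an arithmetic operation, a visit or creation of a list cell and the drawing of a random integer each count as $O(1)$ steps. -/

import Mathlib

open scoped ENNReal

universe u v

/-! ### Clustering with outliers -/

section Clustering

variable {X : Type u} [Fintype X] [MetricSpace X]

/-- `max_{p ∈ S} min_{c ∈ A} d(p, c)`, the cost of serving the vertices of `S` by the centers `A`
(`0` if `S` is empty, `∞` if `S` is non-empty and there is no center). -/
noncomputable def clusterCost (S : Finset X) (A : Set X) : ℝ≥0∞ :=
  ⨆ p ∈ S, Metric.infEDist p A

/-- `φ_ε(X, A)`: the least cost of the centers `A` over all sets `X' ⊆ X` with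
`|X'| ≥ n - (1 + ε) z`. -/
noncomputable def phi (z : ℕ) (ε : ℝ) (A : Set X) : ℝ≥0∞ :=
  ⨅ (S : Finset X) (_ : (Fintype.card X : ℝ) - (1 + ε) * z ≤ S.card), clusterCost S A

variable (X) in
/-- `r_opt`: the optimal cost of `k`-center clustering with `z` outliers, that is the least value of
`max_{p ∈ X'} min_j d(p, c_j)` over all `|X'| ≥ n - z` and all `c_1, …, c_k ∈ X`. -/
noncomputable def optRadius (k z : ℕ) : ℝ≥0∞ :=
  ⨅ c : Fin k → X, phi z 0 (Set.range c)

/-- An optimal solution of `k`-center clustering with `z` outliers: the set `S` of the `n - z`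
inliers, and `k` centers that are themselves inliers and serve `S` at the optimal cost. -/
structure IsOptimalSolution (k z : ℕ) (S : Finset X) (c : Fin k → X) : Prop where
  card_eq : S.card = Fintype.card X - z
  center_mem : ∀ j, c j ∈ S
  cost_eq : clusterCost S (Set.range c) = optRadius X k z

/-- The center set `A` is an `(α, β)`-approximation for `(k, z)_ε`-center clustering: it has at most
`β k` centers and `φ_ε(X, A) ≤ α r_opt`. -/
def IsBicriteriaApprox (k z : ℕ) (ε α β : ℝ) (A : Set X) : Prop :=
  (A.ncard : ℝ) ≤ β * k ∧ phi z ε A ≤ ENNReal.ofReal α * optRadius X k z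

end Clustering

/-- The metric space `M` has doubling dimension at most `ρ`: every ball of radius `2r` is covered
by at most `2 ^ ρ` balls of radius `r`. -/
def DoublingDimLE (M : Type u) [MetricSpace M] (ρ : ℝ) : Prop :=
  ∀ (p : M) (r : ℝ), 0 ≤ r → ∃ B : Finset M, (B.card : ℝ) ≤ (2 : ℝ) ^ ρ ∧
    Metric.closedBall p (2 * r) ⊆ ⋃ b ∈ B, Metric.closedBall b r

/-! ### The parameters of the algorithm, rounded up to integers -/

/-- The number `(1 / (1 - γ)) log (1 / η)`, `γ = z / n`, of vertices sampled initially. -/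
noncomputable def initialSamples (n z : ℕ) (η : ℝ) : ℕ :=
  ⌈1 / (1 - (z : ℝ) / n) * Real.log (1 / η)⌉₊

/-- The number `((1 + ε) / ε) log (1 / η)` of vertices sampled in each round. -/
noncomputable def roundSamples (ε η : ℝ) : ℕ :=
  ⌈(1 + ε) / ε * Real.log (1 / η)⌉₊

/-- The number `(1 + ε) z` of farthest vertices from which each round samples. -/
noncomputable def farCount (z : ℕ) (ε : ℝ) : ℕ :=
  ⌈(1 + ε) * z⌉₊

/-- `t = (2^ρ k + 2^{ρ/2} √k) / (1 - η)`. -/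
noncomputable def doublingRounds (k : ℕ) (ρ η : ℝ) : ℕ :=
  ⌈((2 : ℝ) ^ ρ * k + (2 : ℝ) ^ (ρ / 2) * Real.sqrt k) / (1 - η)⌉₊

/-! ### The random algorithm

The state is the list of all vertices selected so far, the most recent one first; the set `E` is the
set of its entries. -/

/-- `Q` consists of the `q` vertices of `X` that are farthest from `E` (of all vertices if there are
fewer than `q`). -/
def IsFarthest {X : Type u} [Fintype X] [MetricSpace X] (q : ℕ) (E : Set X) (Q : Finset X) : Prop :=
  Q.card = min q (Fintype.card X) ∧
    ∀ x ∈ Q, ∀ y ∉ Q, Metric.infEDist y E ≤ Metric.infEDist x E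

/-- A rule that picks the `q` farthest vertices, breaking ties arbitrarily; the choice may depend on
everything selected so far. -/
def IsFarthestRule {X : Type u} [Fintype X] [MetricSpace X] (q : ℕ) (far : List X → Finset X) :
    Prop :=
  ∀ E : List X, IsFarthest q {x | x ∈ E} (far E)

open Classical in
/-- Add `m` independent uniformly random elements of `Q` to `E`. -/
noncomputable def drawFrom {X : Type u} (Q : Finset X) : ℕ → List X → PMF (List X)
  | 0, E => PMF.pure E
  | m + 1, E =>
    if h : Q.Nonempty then
      (PMF.uniformOfFinset Q h).bind fun x => drawFrom Q m (x :: E)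
    else PMF.pure E

/-- `j` rounds, each adding `m` random elements of the current farthest set to `E`. -/
noncomputable def greedyRounds {X : Type u} (far : List X → Finset X) (m : ℕ) :
    ℕ → List X → PMF (List X)
  | 0, E => PMF.pure E
  | j + 1, E => (drawFrom (far E) m E).bind fun E' => greedyRounds far m j E'

/-- The law of the output of the bi-criteria algorithm with parameters `ε`, `η`, `t` and with the
tie-breaking rule `far`: an initial uniform sample of `X`, and then one round for each
`j = 2, …, t`. -/
noncomputable def biCriteria {X : Type u} [Fintype X] (z : ℕ) (ε η : ℝ) (t : ℕ)
    (far : List X → Finset X) : PMF (List X) :=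
  (drawFrom Finset.univ (initialSamples (Fintype.card X) z η) []).bind fun E =>
    greedyRounds far (roundSamples ε η) (t - 1) E

/-! ### Step counting

Programs work on linked lists. One step is charged for each elementary operation: visiting or
creating a list cell, looking up a distance, comparing two numbers, an arithmetic operation, drawing
a random integer. -/

/-- The result of a computation together with the number of its steps. -/
structure Timed (α : Type u) where
  value : α
  steps : ℕ

namespace Timed

/-- Return a value at no cost. -/
def ret {α : Type u} (a : α) : Timed α := ⟨a, 0⟩

/-- Run `x`, then run `f` on its value; the steps add up. -/
def bind {α : Type u} {β : Type v} (x : Timed α) (f : α → Timed β) : Timed β :=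
  ⟨(f x.value).value, x.steps + (f x.value).steps⟩

/-- Charge `c` additional steps. -/
def charge {α : Type u} (c : ℕ) (x : Timed α) : Timed α := ⟨x.value, c + x.steps⟩

/-- The length of a list. -/
def len {α : Type u} : List α → Timed ℕ
  | [] => charge 1 (ret 0)
  | _ :: l => charge 2 ((len l).bind fun n => ret (n + 1))

/-- The `i`-th entry of a list, counted from `0`. -/
def nth {α : Type u} : List α → ℕ → Timed (Option α)
  | [], _ => charge 1 (ret none)
  | a :: _, 0 => charge 1 (ret (some a))
  | _ :: l, i + 1 => charge 2 (nth l i)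

/-- Apply to all entries of a list a function that takes a bounded number (at most three) of steps,
including the creation of the cell. -/
def mapList {α : Type u} {β : Type v} (f : α → β) : List α → Timed (List β)
  | [] => charge 1 (ret [])
  | a :: l => charge 4 ((mapList f l).bind fun l' => ret (f a :: l'))

/-- The first `m` entries of a list. -/
def takeList {α : Type u} : ℕ → List α → Timed (List α)
  | 0, _ => charge 1 (ret [])
  | _ + 1, [] => charge 1 (ret [])
  | m + 1, a :: l => charge 3 ((takeList m l).bind fun l' => ret (a :: l'))

/-- Concatenation of two lists. -/
def appendList {α : Type u} : List α → List α → Timed (List α)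
  | [], l => charge 1 (ret l)
  | a :: k, l => charge 2 ((appendList k l).bind fun l' => ret (a :: l'))

section Selection

variable {K : Type v} [LinearOrder K]

/-- Insertion into a non-increasing list. -/
def insertDesc (a : K) : List K → Timed (List K)
  | [] => charge 2 (ret [a])
  | b :: l => charge 4 (if b ≤ a then ret (a :: b :: l)
      else (insertDesc a l).bind fun l' => ret (b :: l'))

/-- Insertion sort, in non-increasing order. -/
def sortDesc : List K → Timed (List K)
  | [] => charge 1 (ret [])
  | a :: l => charge 1 ((sortDesc l).bind fun l' => insertDesc a l')

/-- The medians of consecutive groups of five entries; an incomplete last group is dropped. -/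
def groupMedians [Inhabited K] : List K → Timed (List K)
  | a :: b :: c :: d :: e :: l =>
    charge 6 ((sortDesc [a, b, c, d, e]).bind fun s =>
      (nth s 2).bind fun m => (groupMedians l).bind fun ms => ret (m.getD default :: ms))
  | _ => charge 5 (ret [])

/-- The entries greater than `p`, the number of entries equal to `p`, and the entries less than
`p`. -/
def split (p : K) : List K → Timed (List K × ℕ × List K)
  | [] => charge 1 (ret ([], 0, []))
  | a :: l => charge 4 ((split p l).bind fun s =>
      if p < a then ret (a :: s.1, s.2.1, s.2.2)
      else if a < p then ret (s.1, s.2.1, a :: s.2.2)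
      else ret (s.1, s.2.1 + 1, s.2.2))

/-- Linear-time selection by medians of medians: the entry at position `i`, counted from `0`, of the
list `l` in non-increasing order. The first argument bounds the depth of the recursion; the length
of the list is always enough. -/
def selectNth [Inhabited K] : ℕ → List K → ℕ → Timed K
  | 0, _, _ => charge 1 (ret default)
  | f + 1, l, i => (len l).bind fun n =>
    charge 2 (if n < 25 then
      (sortDesc l).bind fun s => (nth s i).bind fun a => ret (a.getD default)
    else
      (groupMedians l).bind fun ms => (len ms).bind fun g => (selectNth f ms (g / 2)).bind fun p =>
      (split p l).bind fun s => (len s.1).bind fun a =>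
      charge 5 (if i < a then selectNth f s.1 i
        else if i < a + s.2.1 then ret p
        else selectNth f s.2.2 (i - a - s.2.1)))

/-- The items of a list of pairs (item, key) whose key is greater than `v`, and those whose key is
equal to `v`. -/
def aboveAndTies {α : Type u} (v : K) : List (α × K) → Timed (List α × List α)
  | [] => charge 1 (ret ([], []))
  | a :: l => charge 4 ((aboveAndTies v l).bind fun s =>
      if v < a.2 then ret (a.1 :: s.1, s.2)
      else if a.2 < v then ret s
      else ret (s.1, a.1 :: s.2))

/-- The `q` items with the greatest keys (all items if there are fewer than `q`). -/
def largest [Inhabited K] {α : Type u} (q : ℕ) (l : List (α × K)) : Timed (List α) :=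
  (len l).bind fun n => charge 2 (if n ≤ q then mapList Prod.fst l else
    (mapList Prod.snd l).bind fun keys => (selectNth n keys (q - 1)).bind fun v =>
    (aboveAndTies v l).bind fun s => (len s.1).bind fun a =>
    (takeList (q - a) s.2).bind fun ties => charge 1 (appendList s.1 ties))

end Selection

end Timed

/-! ### The implementation of the algorithm -/

/-- Run the randomized computation `x`, then run `f` on its value; the steps add up. -/
noncomputable def bindTimed {α : Type u} {β : Type v} (x : PMF (Timed α))
    (f : α → PMF (Timed β)) : PMF (Timed β) :=
  x.bind fun a => (f a.value).map fun b => ⟨b.value, a.steps + b.steps⟩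

/-- A uniformly random element of `{0, …, n - 1}`, in one step. -/
noncomputable def randomIndex (n : ℕ) : PMF (Timed ℕ) :=
  if h : (Finset.range n).Nonempty then (PMF.uniformOfFinset (Finset.range n) h).map fun i => ⟨i, 1⟩
  else PMF.pure ⟨0, 1⟩

section Implementation

variable {X : Type u} [MetricSpace X]

/-- Update the table of the distances to `E` when `x` is added to `E`: for each vertex, look up its
distance to `x` and take the minimum. -/
noncomputable def updateTable (x : X) (tbl : List (X × ℝ≥0∞)) : Timed (List (X × ℝ≥0∞)) :=
  Timed.mapList (fun a => (a.1, min (edist a.1 x) a.2)) tbl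

/-- Draw `m` independent random entries of the list `Q` of length `n`; the state is `E` with the
table of the distances to `E`. -/
noncomputable def drawProgram (Q : List X) (n : ℕ) :
    ℕ → List X × List (X × ℝ≥0∞) → PMF (Timed (List X × List (X × ℝ≥0∞)))
  | 0, s => PMF.pure ⟨s, 1⟩
  | m + 1, s => bindTimed (randomIndex n) fun i =>
      bindTimed (PMF.pure (Timed.charge 2 (Timed.nth Q i))) fun o =>
        match o with
        | none => PMF.pure ⟨s, 1⟩
        | some x => bindTimed (PMF.pure (updateTable x s.2)) fun tbl =>
            drawProgram Q n m (x :: s.1, tbl)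

/-- `j` rounds: find the `q` farthest vertices, and add `m` random ones of them to `E`. -/
noncomputable def roundsProgram (q m : ℕ) :
    ℕ → List X × List (X × ℝ≥0∞) → PMF (Timed (List X))
  | 0, s => PMF.pure ⟨s.1, 1⟩
  | j + 1, s => bindTimed (PMF.pure (Timed.charge 1 (Timed.largest q s.2))) fun Q =>
      bindTimed (PMF.pure (Timed.len Q)) fun n =>
        bindTimed (drawProgram Q n m s) fun s' => roundsProgram q m j s'

/-- The whole program, on the list `vs` of the vertices. The four sample and round counts are part
of the input. -/
noncomputable def biCriteriaProgram (vs : List X) (m₀ q m t : ℕ) : PMF (Timed (List X)) :=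
  bindTimed (PMF.pure (Timed.len vs)) fun n =>
    bindTimed (PMF.pure (Timed.mapList (fun x => (x, (⊤ : ℝ≥0∞))) vs)) fun tbl =>
      bindTimed (drawProgram vs n m₀ ([], tbl)) fun s => roundsProgram q m (t - 1) s

end Implementation

/-! Quality. Write `r` for the optimal radius and κ = 2^ρ k. Every optimal center is an inlier, so
doubling covers its ball of radius `r` in the inliers by at most 2^ρ balls of radius `r/2`;
altogether at most κ half-balls cover the inliers. A half-ball is hit once it contains a selected
inlier; all its points are then within `r` of `E`, and once all half-balls are hit, `φ_ε ≤ r`. As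
long as `φ_ε > r`, more than (1+ε)z vertices are farther than `r` from `E`, hence so is the whole
farthest set. At most z of its vertices are outliers, so a draw gives an inlier with probability at
least ε/(1+ε), and this inlier lies in a half-ball not hit before (`IsFarthest.far_of_lt_phi`). A
round therefore hits a new half-ball with probability at least 1-η (`lexp_drawFrom_le`).

The rounds are not independent, so the tail bound uses an exponential potential in the number of
hits that decreases in expectation by a fixed factor per round (`lexp_greedyRounds_le`); optimizing
roughly over its rate bounds the failure by e = exp(-(1-η)/4) (`exp_mul_pow_le`), once the initial
sample contains an inlier. That fails with probability at most η, so the total failure is at most e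
+ η(1-e), the complement of (1-η)(1-e).

Time. A table of distances to `E` is updated in O(n) steps per draw, and median-of-medians selection
is linear (`selectNth_spec`). Forgetting its steps, the program has exactly the law of the abstract
algorithm for its own tie-breaking rule (`map_value_biCriteriaProgram`). There are O(κ) rounds of
O(1/ε) draws. -/

namespace Timed

/-! ### Values and step counts of the list primitives -/

section Basic

variable {α : Type u} {β : Type v}

@[simp] theorem ret_value (a : α) : (ret a).value = a := rfl
@[simp] theorem ret_steps (a : α) : (ret a).steps = 0 := rfl
@[simp] theorem bind_value (x : Timed α) (f : α → Timed β) :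
    (x.bind f).value = (f x.value).value := rfl
@[simp] theorem bind_steps (x : Timed α) (f : α → Timed β) :
    (x.bind f).steps = x.steps + (f x.value).steps := rfl
@[simp] theorem charge_value (c : ℕ) (x : Timed α) : (charge c x).value = x.value := rfl
@[simp] theorem charge_steps (c : ℕ) (x : Timed α) : (charge c x).steps = c + x.steps := rfl

@[simp] theorem len_value (l : List α) : (len l).value = l.length := by
  induction l with
  | nil => rfl
  | cons a l ih => simp [len, ih]

@[simp] theorem len_steps (l : List α) : (len l).steps = 2 * l.length + 1 := by
  induction l with
  | nil => rfl
  | cons a l ih => simp [len, ih]; ring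

@[simp] theorem nth_value (l : List α) (i : ℕ) : (nth l i).value = l[i]? := by
  induction l generalizing i with
  | nil => simp [nth]
  | cons a l ih => cases i <;> simp [nth, ih]

theorem nth_steps_le (l : List α) (i : ℕ) : (nth l i).steps ≤ 2 * l.length + 1 := by
  induction l generalizing i with
  | nil => simp [nth]
  | cons a l ih =>
    cases i with
    | zero => simp [nth]
    | succ i => have := ih i; simp [nth]; omega

@[simp] theorem mapList_value (f : α → β) (l : List α) : (mapList f l).value = l.map f := by
  induction l with
  | nil => rfl
  | cons a l ih => simp [mapList, ih]

@[simp] theorem mapList_steps (f : α → β) (l : List α) :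
    (mapList f l).steps = 4 * l.length + 1 := by
  induction l with
  | nil => rfl
  | cons a l ih => simp [mapList, ih]; ring

@[simp] theorem takeList_value (m : ℕ) (l : List α) : (takeList m l).value = l.take m := by
  induction l generalizing m with
  | nil => cases m <;> simp [takeList]
  | cons a l ih => cases m <;> simp [takeList, ih]

theorem takeList_steps_le (m : ℕ) (l : List α) : (takeList m l).steps ≤ 3 * l.length + 1 := by
  induction l generalizing m with
  | nil => cases m <;> simp [takeList]
  | cons a l ih =>
    cases m with
    | zero => simp [takeList]
    | succ m => have := ih m; simp [takeList]; omega

@[simp] theorem appendList_value (k l : List α) : (appendList k l).value = k ++ l := by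
  induction k with
  | nil => rfl
  | cons a k ih => simp [appendList, ih]

@[simp] theorem appendList_steps (k l : List α) :
    (appendList k l).steps = 2 * k.length + 1 := by
  induction k with
  | nil => rfl
  | cons a k ih => simp [appendList, ih]; ring

end Basic

/-! ### Correctness and linear running time of selection -/

section Selection

variable {K : Type v} [LinearOrder K]

theorem insertDesc_perm (a : K) (l : List K) : (insertDesc a l).value.Perm (a :: l) := by
  induction l with
  | nil => simp [insertDesc]
  | cons b l ih =>
    by_cases h : b ≤ a
    · simp [insertDesc, h]
    · simpa [insertDesc, h] using (ih.cons b).trans (List.Perm.swap a b l)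

theorem insertDesc_sorted (a : K) {l : List K} (hl : l.Pairwise (· ≥ ·)) :
    (insertDesc a l).value.Pairwise (· ≥ ·) := by
  induction l with
  | nil => simp [insertDesc]
  | cons b l ih =>
    have hl' := List.pairwise_cons.1 hl
    by_cases h : b ≤ a
    · simp only [insertDesc, h, if_true, charge_value, ret_value, List.pairwise_cons]
      refine ⟨fun x hx => ?_, hl'⟩
      rcases List.mem_cons.1 hx with rfl | hx
      · exact h
      · exact (hl'.1 x hx).trans h
    · simp only [insertDesc, h, if_false, charge_value, bind_value, ret_value,
        List.pairwise_cons]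
      refine ⟨fun x hx => ?_, ih hl'.2⟩
      rcases List.mem_cons.1 ((insertDesc_perm a l).mem_iff.1 hx) with rfl | hx
      · exact (not_le.1 h).le
      · exact hl'.1 x hx

theorem insertDesc_steps_le (a : K) (l : List K) :
    (insertDesc a l).steps ≤ 4 * l.length + 2 := by
  induction l with
  | nil => simp [insertDesc]
  | cons b l ih =>
    by_cases h : b ≤ a
    · simp [insertDesc, h]; omega
    · simp [insertDesc, h]; omega

theorem sortDesc_perm (l : List K) : (sortDesc l).value.Perm l := by
  induction l with
  | nil => simp [sortDesc]
  | cons a l ih =>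
    simpa [sortDesc] using (insertDesc_perm a _).trans (ih.cons a)

theorem sortDesc_sorted (l : List K) : (sortDesc l).value.Pairwise (· ≥ ·) := by
  induction l with
  | nil => simp [sortDesc]
  | cons a l ih => simpa [sortDesc] using insertDesc_sorted a ih

@[simp] theorem sortDesc_length (l : List K) : (sortDesc l).value.length = l.length :=
  (sortDesc_perm l).length_eq

theorem sortDesc_steps_le (l : List K) {N : ℕ} (hN : l.length ≤ N) :
    (sortDesc l).steps ≤ (4 * N + 3) * l.length + 1 := by
  induction l with
  | nil => simp [sortDesc]
  | cons a l ih =>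
    have h1 := insertDesc_steps_le a (sortDesc l).value
    rw [List.length_cons] at hN
    have h2 := ih (by omega)
    rw [sortDesc_length] at h1
    simp only [sortDesc, charge_steps, bind_steps, List.length_cons, mul_add, mul_one]
    omega

/-- `v` is a possible value of the entry at position `i`, counted from `0`, of the list `l` in
non-increasing order. -/
def IsRank (l : List K) (i : ℕ) (v : K) : Prop :=
  l.countP (fun a => v < a) ≤ i ∧ i < l.countP (fun a => v ≤ a)

theorem IsRank.of_perm {l l' : List K} (h : l.Perm l') {i : ℕ} {v : K} (hv : IsRank l i v) :
    IsRank l' i v := by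
  unfold IsRank at *
  rwa [← h.countP_eq, ← h.countP_eq]

theorem isRank_getElem {l : List K} (hl : l.Pairwise (· ≥ ·)) {i : ℕ} (hi : i < l.length) :
    IsRank l i l[i] := by
  have key := List.pairwise_iff_getElem.1 hl
  obtain ⟨v, hv⟩ : ∃ v, v = l[i] := ⟨_, rfl⟩
  rw [← hv]
  constructor
  · rw [← List.take_append_drop i l, List.countP_append]
    have h0 : (l.drop i).countP (fun a => v < a) = 0 := by
      rw [List.countP_eq_zero]
      intro a ha
      obtain ⟨j, hj, rfl⟩ := List.getElem_of_mem ha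
      rw [List.getElem_drop]
      simp only [decide_eq_true_eq, not_lt]
      rcases Nat.eq_zero_or_pos j with rfl | hj0
      · simp [hv]
      · rw [hv]; exact key _ _ _ _ (by omega)
    have h1 : (l.take i).countP (fun a => v < a) ≤ (l.take i).length := List.countP_le_length
    have h2 : (l.take i).length ≤ i := by simp
    omega
  · have h1 : (l.take (i + 1)).countP (fun a => v ≤ a) = (l.take (i + 1)).length := by
      rw [List.countP_eq_length]
      intro a ha
      obtain ⟨j, hj, rfl⟩ := List.getElem_of_mem ha
      rw [List.getElem_take]
      simp only [decide_eq_true_eq]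
      rw [List.length_take] at hj
      rcases Nat.lt_or_ge j i with h | h
      · rw [hv]; exact key _ _ _ _ h
      · obtain rfl : j = i := by omega
        exact hv.le
    have h2 : (l.take (i + 1)).length = i + 1 := by simp; omega
    have h3 := (List.take_sublist (i + 1) l).countP_le (p := fun a => decide (v ≤ a))
    omega

theorem isRank_sortDesc [Inhabited K] (l : List K) {i : ℕ} (hi : i < l.length) :
    IsRank l i ((nth (sortDesc l).value i).value.getD default) := by
  have hi' : i < (sortDesc l).value.length := by simpa using hi
  have h := (isRank_getElem (sortDesc_sorted l) hi').of_perm (sortDesc_perm l)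
  simpa [List.getElem?_eq_getElem hi'] using h

theorem groupMedians_length [Inhabited K] (l : List K) :
    (groupMedians l).value.length = l.length / 5 := by
  induction l using groupMedians.induct with
  | case1 a b c d e l ih => simp [groupMedians, ih]; omega
  | case2 l h =>
    have : l.length < 5 := by
      rcases l with _ | ⟨a, _ | ⟨b, _ | ⟨c, _ | ⟨d, _ | ⟨e, l⟩⟩⟩⟩⟩ <;> simp
      exact (h _ _ _ _ _ _ rfl).elim
    rw [groupMedians.eq_2 l h]
    simp; omega

theorem groupMedians_steps_le [Inhabited K] (l : List K) :
    (groupMedians l).steps ≤ 30 * l.length + 5 := by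
  induction l using groupMedians.induct with
  | case1 a b c d e l ih =>
    have h1 := sortDesc_steps_le [a, b, c, d, e] (N := 5) (by simp)
    have h2 := nth_steps_le (sortDesc [a, b, c, d, e]).value 2
    simp only [sortDesc_length, List.length_cons, List.length_nil] at h1 h2
    simp only [groupMedians, charge_steps, bind_steps, List.length_cons, ret_steps]
    omega
  | case2 l h =>
    rw [groupMedians.eq_2 l h]
    simp

/-- In a group of five, three entries are at least the median and three are at most it. So each
median on one side of `p` brings three entries of its group to that side. -/
theorem three_mul_countP_le [Inhabited K] (l : List K) (p : K) :
    3 * (groupMedians l).value.countP (fun a => p ≤ a) ≤ l.countP (fun a => p ≤ a) ∧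
    3 * (groupMedians l).value.countP (fun a => a ≤ p) ≤ l.countP (fun a => a ≤ p) := by
  induction l using groupMedians.induct with
  | case1 a b c d e l ih =>
    have hr := isRank_sortDesc [a, b, c, d, e] (i := 2) (by simp)
    set m := (nth (sortDesc [a, b, c, d, e]).value 2).value.getD default with hm
    have hval : (groupMedians (a :: b :: c :: d :: e :: l)).value
        = m :: (groupMedians l).value := rfl
    have happ : a :: b :: c :: d :: e :: l = [a, b, c, d, e] ++ l := rfl
    rw [hval, List.countP_cons (l := (groupMedians l).value),
      List.countP_cons (l := (groupMedians l).value), happ, List.countP_append,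
      List.countP_append]
    have h1 : [a, b, c, d, e].countP (fun x => m < x) + [a, b, c, d, e].countP (fun x => x ≤ m)
        = 5 := by
      have := List.length_eq_countP_add_countP (fun x => decide (m < x)) (l := [a, b, c, d, e])
      simp only [decide_eq_true_eq, not_lt] at this
      exact this.symm
    obtain ⟨hr1, hr2⟩ := hr
    constructor
    · by_cases hp : p ≤ m
      · have : [a, b, c, d, e].countP (fun x => m ≤ x) ≤ [a, b, c, d, e].countP (fun x => p ≤ x) :=
          List.countP_mono_left fun x _ hx => by simpa using hp.trans (by simpa using hx)
        simp only [hp, decide_true, if_true]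
        omega
      · simp only [hp, decide_false]
        simp only [Bool.false_eq_true, if_false]
        omega
    · by_cases hp : m ≤ p
      · have : [a, b, c, d, e].countP (fun x => x ≤ m) ≤ [a, b, c, d, e].countP (fun x => x ≤ p) :=
          List.countP_mono_left fun x _ hx => by
            simpa using le_trans (by simpa using hx) hp
        simp only [hp, decide_true, if_true]
        omega
      · simp only [hp, decide_false]
        simp only [Bool.false_eq_true, if_false]
        omega
  | case2 l h =>
    rw [groupMedians.eq_2 l h]
    simp

theorem split_value (p : K) (l : List K) :
    (split p l).value = (l.filter (fun a => p < a), l.countP (fun a => a = p),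
      l.filter (fun a => a < p)) := by
  induction l with
  | nil => rfl
  | cons a l ih =>
    rcases lt_trichotomy p a with h | rfl | h
    · simp [split, ih, h, h.not_gt, h.ne']
    · simp [split, ih]
    · simp [split, ih, h, h.not_gt, h.ne]

theorem split_steps (p : K) (l : List K) : (split p l).steps = 4 * l.length + 1 := by
  induction l with
  | nil => rfl
  | cons a l ih =>
    simp only [split, charge_steps, bind_steps, List.length_cons, ih]
    split_ifs <;> simp <;> ring

theorem countP_trichotomy (p : K) (l : List K) :
    l.countP (fun a => p < a) + l.countP (fun a => a = p) + l.countP (fun a => a < p) =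
      l.length := by
  induction l with
  | nil => rfl
  | cons a l ih =>
    rcases lt_trichotomy p a with h | h | h
    · simp [h, h.not_gt, h.ne']; omega
    · simp [h]; subst h; omega
    · simp [h, h.not_gt, h.ne]; omega

theorem countP_le_eq (p : K) (l : List K) :
    l.countP (fun a => p ≤ a) = l.countP (fun a => p < a) + l.countP (fun a => a = p) := by
  induction l with
  | nil => rfl
  | cons a l ih =>
    rcases lt_trichotomy p a with h | h | h
    · simp [h, h.le, h.ne']; omega
    · simp [h]; subst h; omega
    · simp [h, h.not_gt, h.ne]; omega

theorem countP_ge_eq (p : K) (l : List K) :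
    l.countP (fun a => a ≤ p) = l.countP (fun a => a < p) + l.countP (fun a => a = p) := by
  induction l with
  | nil => rfl
  | cons a l ih =>
    rcases lt_trichotomy p a with h | h | h
    · simp [h, h.not_gt, h.ne']; omega
    · simp [h]; subst h; omega
    · simp [h, h.le, h.ne]; omega

theorem IsRank.of_filter_gt {p v : K} {l : List K} {i : ℕ}
    (hi : i < l.countP (fun a => p < a)) (h : IsRank (l.filter (fun a => p < a)) i v) :
    IsRank l i v := by
  obtain ⟨h1, h2⟩ := h
  rw [List.countP_filter] at h1 h2
  -- If `v ≤ p`, all entries of the filtered list would exceed `v`; there are more than `i` of them,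
  -- against the rank condition.
  have hpv : p < v := by
    by_contra hvp
    have : l.countP (fun a => decide (v < a) && decide (p < a)) = l.countP (fun a => p < a) := by
      apply List.countP_congr
      intro a _
      simp only [Bool.and_eq_true, decide_eq_true_eq, and_iff_right_iff_imp]
      exact fun h => (not_lt.1 hvp).trans_lt h
    omega
  constructor
  · refine le_trans (List.countP_mono_left ?_) h1
    intro a _ ha
    simp only [decide_eq_true_eq, Bool.and_eq_true] at *
    exact ⟨ha, hpv.trans ha⟩
  · refine h2.trans_le (List.countP_mono_left ?_)
    intro a _ ha
    simp only [decide_eq_true_eq, Bool.and_eq_true] at *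
    exact ha.1

theorem IsRank.of_filter_lt {p v : K} {l : List K} {i : ℕ}
    (h : IsRank (l.filter (fun a => a < p)) i v) :
    IsRank l (l.countP (fun a => p ≤ a) + i) v := by
  obtain ⟨h1, h2⟩ := h
  rw [List.countP_filter] at h1 h2
  have hvp : v < p := by
    obtain ⟨a, _, ha⟩ := List.countP_pos_iff.1 (Nat.zero_lt_of_lt h2)
    simp only [Bool.and_eq_true, decide_eq_true_eq] at ha
    exact ha.1.trans_lt ha.2
  -- Used for `v < a` and `v ≤ a`: both hold for every `a ≥ p`, so both counts shift by the same
  -- amount.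
  have aux : ∀ (r : K → Prop) [DecidablePred r], (∀ a, p ≤ a → r a) →
      l.countP (fun a => r a) =
        l.countP (fun a => p ≤ a) + l.countP (fun a => decide (r a) && decide (a < p)) := by
    intro r _ hr
    clear h1 h2
    induction l with
    | nil => rfl
    | cons a l ih =>
      rcases le_or_gt p a with h | h
      · simp [h, hr a h, ih]; omega
      · simp [List.countP_cons, h, h.not_ge, ih]; omega
  constructor
  · rw [aux _ fun a ha => hvp.trans_le ha]
    omega
  · rw [aux _ fun a ha => hvp.le.trans ha]
    omega

/-- Half of the n/5 medians lie on either side of the pivot, so by `three_mul_countP_le` each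
recursive part has at most about 7n/10 entries. Since 1/5 + 7/10 < 1, the recursion leaves a surplus
of about 200n steps to pay for the linear work; for n ≥ 25 this also absorbs the rounding errors. -/
theorem selectNth_spec [Inhabited K] (f : ℕ) (l : List K) (i : ℕ) (hf : l.length ≤ f)
    (hi : i < l.length) :
    IsRank l i (selectNth f l i).value ∧ (selectNth f l i).steps ≤ 2000 * l.length + 100 := by
  induction f generalizing l i with
  | zero => omega
  | succ f ih =>
    by_cases hn : l.length < 25
    · constructor
      · simpa [selectNth, hn] using isRank_sortDesc l hi
      · have h1 := sortDesc_steps_le l (N := 24) (by omega)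
        have h2 := nth_steps_le (sortDesc l).value i
        rw [sortDesc_length] at h2
        simp only [selectNth, charge_steps, bind_steps, hn, len_value, len_steps, if_true, ret_steps]
        omega
    · set ms := (groupMedians l).value with hms
      have hg : ms.length = l.length / 5 := groupMedians_length l
      obtain ⟨⟨hr1, hr2⟩, ht⟩ := ih ms (ms.length / 2) (by omega) (by omega)
      set p := (selectNth f ms (ms.length / 2)).value with hp
      obtain ⟨hm1, hm2⟩ := three_mul_countP_le l p
      rw [← hms] at hm1 hm2
      have e1 := countP_trichotomy p l
      have e2 := countP_le_eq p l
      have e3 := countP_ge_eq p l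
      have e1' := countP_trichotomy p ms
      have e3' := countP_ge_eq p ms
      have hgs := groupMedians_steps_le l
      simp only [selectNth, charge_steps, charge_value, bind_steps, bind_value, hn, len_value,
        len_steps, if_false, ← hms, ← hp, split_value, split_steps]
      rw [← List.countP_eq_length_filter]
      have hlt := List.countP_eq_length_filter (p := fun a => decide (a < p)) (l := l)
      have hgt := List.countP_eq_length_filter (p := fun a => decide (p < a)) (l := l)
      split_ifs with c1 c2
      · obtain ⟨r, s⟩ := ih (l.filter (fun a => p < a)) i (by omega) (by omega)
        exact ⟨r.of_filter_gt c1, by omega⟩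
      · refine ⟨⟨not_lt.1 c1, lt_of_lt_of_eq c2 e2.symm⟩, ?_⟩
        simp only [ret_steps]
        omega
      · obtain ⟨r, s⟩ := ih (l.filter (fun a => a < p))
          (i - l.countP (fun a => p < a) - l.countP (fun a => a = p)) (by omega) (by omega)
        refine ⟨?_, by omega⟩
        have := r.of_filter_lt
        rwa [show l.countP (fun a => p ≤ a) +
          (i - l.countP (fun a => p < a) - l.countP (fun a => a = p)) = i by omega] at this

theorem aboveAndTies_value {α : Type u} (v : K) (l : List (α × K)) :
    (aboveAndTies v l).value = ((l.filter (fun a => v < a.2)).map Prod.fst,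
      (l.filter (fun a => a.2 = v)).map Prod.fst) := by
  induction l with
  | nil => rfl
  | cons a l ih =>
    rcases lt_trichotomy v a.2 with h | h | h
    · simp [aboveAndTies, ih, h, h.ne']
    · simp [aboveAndTies, ih, ← h]
    · simp [aboveAndTies, ih, h, h.not_gt, h.ne]

theorem aboveAndTies_steps {α : Type u} (v : K) (l : List (α × K)) :
    (aboveAndTies v l).steps = 4 * l.length + 1 := by
  induction l with
  | nil => rfl
  | cons a l ih =>
    simp only [aboveAndTies, charge_steps, bind_steps, List.length_cons, ih]
    split_ifs <;> simp <;> ring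

theorem largest_steps_le [Inhabited K] {α : Type u} {q : ℕ} (hq : 0 < q) (l : List (α × K)) :
    (largest q l).steps ≤ 2020 * l.length + 120 := by
  by_cases h : l.length ≤ q
  · simp [largest, h]; omega
  · have h1 := (selectNth_spec (l.map Prod.snd).length (l.map Prod.snd) (q - 1) le_rfl
      (by simp; omega)).2
    simp only [List.length_map] at h1
    simp only [largest, h, if_false, charge_steps, bind_steps, len_steps, len_value, mapList_steps,
      mapList_value, aboveAndTies_steps, aboveAndTies_value, appendList_steps, List.length_map]
    set v := (selectNth l.length (l.map Prod.snd) (q - 1)).value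
    have h2 := List.length_filter_le (fun a : α × K => decide (v < a.2)) l
    have h3 := List.length_filter_le (fun a : α × K => decide (a.2 = v)) l
    have h4 := takeList_steps_le (q - (l.filter (fun a => v < a.2)).length)
      ((l.filter (fun a => a.2 = v)).map Prod.fst)
    simp only [List.length_map] at h4
    omega

/-- The selected key `v` has position `q - 1`: at most `q - 1` keys exceed it and at least `q` keys
reach it. Filling up with ties therefore gives exactly `q` items. -/
theorem largest_map_value_spec [Inhabited K] {α : Type u} {q : ℕ} (hq : 0 < q) {vs : List α}
    (hvs : vs.Nodup) (key : α → K) :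
    (largest q (vs.map fun x => (x, key x))).value.Nodup ∧
    (largest q (vs.map fun x => (x, key x))).value.length = min q vs.length ∧
    (∀ x ∈ (largest q (vs.map fun x => (x, key x))).value, x ∈ vs) ∧
    ∀ x ∈ (largest q (vs.map fun x => (x, key x))).value, ∀ y ∈ vs,
      y ∉ (largest q (vs.map fun x => (x, key x))).value → key y ≤ key x := by
  by_cases h : vs.length ≤ q
  · have : (largest q (vs.map fun x => (x, key x))).value = vs := by
      simp [largest, h, Function.comp_def]
    rw [this]
    exact ⟨hvs, by omega, fun x hx => hx, fun x _ y hy hy' => absurd hy hy'⟩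
  · obtain ⟨h1, h2⟩ := (selectNth_spec vs.length (vs.map key) (q - 1) (by simp)
      (by simp; omega)).1
    set v := (selectNth vs.length (vs.map key) (q - 1)).value with hv
    have hval : (largest q (vs.map fun x => (x, key x))).value =
        vs.filter (fun x => v < key x) ++
          (vs.filter (fun x => key x = v)).take (q - (vs.filter (fun x => v < key x)).length) := by
      simp only [largest, charge_value, bind_value, len_value, List.length_map, h, if_false,
        mapList_value, List.map_map, aboveAndTies_value, appendList_value, takeList_value,
        List.filter_map]
      simp only [Function.comp_def, ← hv, List.map_id']
    rw [hval]
    rw [countP_le_eq] at h2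
    rw [List.countP_map, List.countP_eq_length_filter] at h1 h2
    rw [List.countP_map, List.countP_eq_length_filter (p := (fun a => decide (a = v)) ∘ key)] at h2
    simp only [Function.comp_def] at h1 h2
    refine ⟨?_, ?_, ?_, ?_⟩
    · refine List.Nodup.append (hvs.filter _) ((hvs.filter _).sublist (List.take_sublist _ _)) ?_
      intro x hx hx'
      have a1 := (List.mem_filter.1 hx).2
      have a2 := (List.mem_filter.1 (List.mem_of_mem_take hx')).2
      simp only [decide_eq_true_eq] at a1 a2
      exact a1.ne' a2
    · rw [List.length_append, List.length_take]
      omega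
    · intro x hx
      rcases List.mem_append.1 hx with hx | hx
      · exact (List.mem_filter.1 hx).1
      · exact (List.mem_filter.1 (List.mem_of_mem_take hx)).1
    · intro x hx y hy hy'
      have hx' : v ≤ key x := by
        rcases List.mem_append.1 hx with hx | hx
        · have := (List.mem_filter.1 hx).2
          simp only [decide_eq_true_eq] at this
          exact this.le
        · have := (List.mem_filter.1 (List.mem_of_mem_take hx)).2
          simp only [decide_eq_true_eq] at this
          exact this.ge
      refine le_trans (not_lt.1 fun hlt => hy' ?_) hx'
      exact List.mem_append_left _ (List.mem_filter.2 ⟨hy, by simpa using hlt⟩)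

end Selection

end Timed

/-! ### Expectations of non-negative functions -/

/-- The expectation of `f` under `p`. -/
noncomputable def PMF.lexp {α : Type u} (p : PMF α) (f : α → ℝ≥0∞) : ℝ≥0∞ := ∑' a, p a * f a

namespace PMF

variable {α : Type u} {β : Type v}

@[simp] theorem lexp_pure (a : α) (f : α → ℝ≥0∞) : (PMF.pure a).lexp f = f a := by
  classical
  unfold lexp
  rw [tsum_eq_single a]
  · simp
  · intro b hb; simp [PMF.pure_apply, hb]

theorem lexp_bind (p : PMF α) (g : α → PMF β) (f : β → ℝ≥0∞) :
    (p.bind g).lexp f = p.lexp fun a => (g a).lexp f := by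
  simp only [lexp, PMF.bind_apply, ← ENNReal.tsum_mul_right, ← ENNReal.tsum_mul_left]
  rw [ENNReal.tsum_comm]
  simp only [mul_assoc]

theorem lexp_mono (p : PMF α) {f g : α → ℝ≥0∞} (h : ∀ a, f a ≤ g a) : p.lexp f ≤ p.lexp g :=
  ENNReal.tsum_le_tsum fun a => mul_le_mul_right (h a) _

@[simp] theorem lexp_const (p : PMF α) (c : ℝ≥0∞) : (p.lexp fun _ => c) = c := by
  simp [lexp, ENNReal.tsum_mul_right]

theorem lexp_uniformOfFinset (Q : Finset α) (hQ : Q.Nonempty) (f : α → ℝ≥0∞) :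
    (PMF.uniformOfFinset Q hQ).lexp f = (Q.card : ℝ≥0∞)⁻¹ * ∑ x ∈ Q, f x := by
  classical
  unfold lexp
  rw [tsum_eq_sum (s := Q), Finset.mul_sum]
  · refine Finset.sum_congr rfl fun x hx => ?_
    rw [PMF.uniformOfFinset_apply_of_mem hQ hx]
  · intro x hx
    rw [PMF.uniformOfFinset_apply_of_notMem hQ hx, zero_mul]

open Classical in
theorem one_sub_le_toOuterMeasure (p : PMF α) (A : Set α) {c : ℝ≥0∞}
    (h : (p.lexp fun a => if a ∈ A then 0 else 1) ≤ c) : 1 - c ≤ p.toOuterMeasure A := by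
  rw [tsub_le_iff_left]
  have : (1 : ℝ≥0∞) = (p.lexp fun a => if a ∈ A then 0 else 1) + p.toOuterMeasure A := by
    rw [PMF.toOuterMeasure_apply, lexp, ← ENNReal.tsum_add, ← p.tsum_coe]
    refine tsum_congr fun a => ?_
    by_cases ha : a ∈ A <;> simp [ha]
  rw [this]
  gcongr

end PMF

/-! ### Sampling -/

theorem lexp_uniformOfFinset_le {X : Type u} (Q : Finset X) (hQ : Q.Nonempty) (G : Finset X)
    (hG : G ⊆ Q) (f : X → ℝ≥0∞) {b c : ℝ≥0∞} (hb : ∀ x ∈ G, f x ≤ b)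
    (hc : ∀ x ∈ Q, f x ≤ b + c) :
    (PMF.uniformOfFinset Q hQ).lexp f ≤ b + ENNReal.ofReal (1 - (G.card : ℝ) / Q.card) * c := by
  classical
  have hQ0 : (0 : ℝ) < Q.card := by exact_mod_cast hQ.card_pos
  have hle : (G.card : ℝ) ≤ Q.card := by exact_mod_cast Finset.card_le_card hG
  have hp : ENNReal.ofReal (1 - (G.card : ℝ) / Q.card) =
      (Q.card : ℝ≥0∞)⁻¹ * ((Q \ G).card : ℝ≥0∞) := by
    rw [one_sub_div hQ0.ne', ENNReal.ofReal_div_of_pos hQ0, div_eq_mul_inv, mul_comm,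
      ENNReal.ofReal_natCast]
    congr 1
    rw [Finset.card_sdiff_of_subset hG, ← ENNReal.ofReal_natCast,
      Nat.cast_sub (Finset.card_le_card hG)]
  have hQ1 : (Q.card : ℝ≥0∞)⁻¹ * (Q.card : ℝ≥0∞) = 1 :=
    ENNReal.inv_mul_cancel (by simpa using hQ.ne_empty) (by simp)
  rw [PMF.lexp_uniformOfFinset, hp]
  calc (Q.card : ℝ≥0∞)⁻¹ * ∑ x ∈ Q, f x
      ≤ (Q.card : ℝ≥0∞)⁻¹ * ∑ x ∈ Q, (b + if x ∈ Q \ G then c else 0) := by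
        gcongr with x hx
        by_cases hxG : x ∈ G
        · simpa [hxG] using hb x hxG
        · simpa [hxG, hx] using hc x hx
    _ = (Q.card : ℝ≥0∞)⁻¹ * (Q.card * b + (Q \ G).card * c) := by
        rw [Finset.sum_add_distrib, Finset.sum_const, nsmul_eq_mul, ← Finset.sum_filter,
          Finset.sum_const, nsmul_eq_mul]
        congr 5
        ext x; simp +contextual
    _ = b + (Q.card : ℝ≥0∞)⁻¹ * ((Q \ G).card : ℝ≥0∞) * c := by
        rw [mul_add, ← mul_assoc, hQ1, one_mul, mul_assoc]

theorem lexp_drawFrom_le_self {X : Type u} (Q : Finset X) (f : List X → ℝ≥0∞)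
    (hf : ∀ E x, f (x :: E) ≤ f E) (m : ℕ) (E : List X) : (drawFrom Q m E).lexp f ≤ f E := by
  induction m generalizing E with
  | zero => simp [drawFrom]
  | succ m ih =>
    by_cases hQ : Q.Nonempty
    · simp only [drawFrom, hQ, dif_pos, PMF.lexp_bind]
      exact (PMF.lexp_mono _ fun x => (ih _).trans (hf E x)).trans (by simp)
    · simp [drawFrom, hQ]

/-- If an antitone function `f` of the state is at most `b` after the draw of an element of `G`,
and at most `b + c` in any case, then its expectation after `m` draws from `Q` exceeds `b` by at
most `c` times the probability to miss `G`. -/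
theorem lexp_drawFrom_le {X : Type u} (Q G : Finset X) (hG : G ⊆ Q) (hQ : Q.Nonempty)
    (f : List X → ℝ≥0∞) (hf : ∀ E x, f (x :: E) ≤ f E) {b c : ℝ≥0∞} {m : ℕ} {E : List X} {η : ℝ}
    (hη : (1 - (G.card : ℝ) / Q.card) ^ m ≤ η)
    (hb : ∀ E', E ⊆ E' → ∀ x ∈ G, f (x :: E') ≤ b) (hc : f E ≤ b + c) :
    (drawFrom Q m E).lexp f ≤ b + ENNReal.ofReal η * c := by
  have hQ0 : (0 : ℝ) < Q.card := by exact_mod_cast hQ.card_pos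
  have hle : (G.card : ℝ) / Q.card ≤ 1 :=
    (div_le_one hQ0).2 (by exact_mod_cast Finset.card_le_card hG)
  -- The induction needs the exact power of the miss probability; a draw from `G` settles the bound
  -- `b`, because later draws only lower `f`.
  suffices (drawFrom Q m E).lexp f ≤ b + ENNReal.ofReal (1 - (G.card : ℝ) / Q.card) ^ m * c by
    refine this.trans ?_
    rw [← ENNReal.ofReal_pow (by linarith)]
    gcongr
  clear hη
  induction m generalizing E with
  | zero => simpa [drawFrom] using hc
  | succ m ih =>
    simp only [drawFrom, hQ, dif_pos, PMF.lexp_bind]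
    refine (lexp_uniformOfFinset_le Q hQ G hG _ (b := b)
      (c := ENNReal.ofReal (1 - (G.card : ℝ) / Q.card) ^ m * c) ?_ ?_).trans_eq ?_
    · exact fun x hx => (lexp_drawFrom_le_self Q f hf m _).trans
        (hb E (List.Subset.refl E) x hx)
    · intro x _
      exact ih (fun E' hE' => hb E' fun y hy => hE' (List.mem_cons_of_mem _ hy))
        ((hf E x).trans hc)
    · rw [pow_succ', mul_assoc]

/-- This justifies both sample sizes: `1 - L ≤ exp (-x)`, and `x * m ≥ log (1 / η)`. -/
theorem one_sub_pow_le {x L η : ℝ} (hx : 0 < x) (hη : 0 < η) {m : ℕ}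
    (hm : 1 / x * Real.log (1 / η) ≤ m) (hL : x ≤ L) (hL1 : L ≤ 1) : (1 - L) ^ m ≤ η := by
  have h1 : 1 - L ≤ Real.exp (-x) := by linarith [Real.add_one_le_exp (-x)]
  calc (1 - L) ^ m ≤ Real.exp (-x) ^ m := pow_le_pow_left₀ (by linarith) h1 m
    _ = Real.exp (-(x * m)) := by rw [← Real.exp_nat_mul]; ring_nf
    _ ≤ Real.exp (-(Real.log (1 / η))) := by
        apply Real.exp_le_exp.2
        have := mul_le_mul_of_nonneg_left hm hx.le
        rw [← mul_assoc, mul_one_div_cancel hx.ne', one_mul] at this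
        linarith
    _ = η := by rw [Real.log_div one_ne_zero hη.ne', Real.log_one, zero_sub, neg_neg,
        Real.exp_log hη]

/-- An exponential tail bound for the number of rounds: if each round, until success, raises the
counter `hits`, which is less than `K` before success, with probability at least `1 - η`, then
failure after `j` rounds is unlikely. -/
theorem lexp_greedyRounds_le {X : Type u} (far : List X → Finset X) (m K : ℕ) {η s : ℝ}
    (hη : 0 ≤ η) (hs : 0 ≤ s) (hits : List X → ℕ) (fail : List X → ℝ≥0∞)
    (hh : ∀ E x, hits E ≤ hits (x :: E)) (hfail : ∀ E, fail E ≤ 1)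
    (hfail' : ∀ E x, fail (x :: E) ≤ fail E)
    (hK : ∀ E, fail E ≠ 0 → hits E < K)
    (hQ : ∀ E, (far E).Nonempty)
    (hstep : ∀ E, fail E ≠ 0 → ∃ G ⊆ far E, (1 - (G.card : ℝ) / (far E).card) ^ m ≤ η ∧
      ∀ E', E ⊆ E' → ∀ x ∈ G, hits E < hits (x :: E'))
    (j : ℕ) (E : List X) :
    (greedyRounds far m j E).lexp fail ≤ ENNReal.ofReal
      (Real.exp (s * (K - 1 - hits E)) * (Real.exp (-s) + η * (1 - Real.exp (-s))) ^ j) := by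
  classical
  -- An upper bound for the expected factor of the potential in one round: `exp (-s)` with a new
  -- hit, at most 1 without, the latter with probability at most `η`.
  set q : ℝ := Real.exp (-s) + η * (1 - Real.exp (-s)) with hq
  have hs1 : 0 ≤ 1 - Real.exp (-s) := sub_nonneg.2 (Real.exp_le_one_iff.2 (by linarith))
  have hq0 : 0 ≤ q := add_nonneg (Real.exp_pos _).le (mul_nonneg hη hs1)
  -- The potential with `j` rounds to go. It is set to 0 after success, where the counter need not
  -- grow any more.
  let F : ℕ → List X → ℝ≥0∞ := fun j E => if fail E = 0 then 0 else
    ENNReal.ofReal (Real.exp (s * (K - 1 - hits E)) * q ^ j)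
  have hF : ∀ j E, F j E ≤ ENNReal.ofReal (Real.exp (s * (K - 1 - hits E)) * q ^ j) := by
    intro j E; simp only [F]; split_ifs <;> simp
  have mono : ∀ (j h : ℕ) E, h ≤ hits E →
      F j E ≤ ENNReal.ofReal (Real.exp (s * (K - 1 - h)) * q ^ j) := by
    intro j h E hE
    refine (hF j E).trans ?_
    gcongr
  have anti : ∀ j E x, F j (x :: E) ≤ F j E := by
    intro j E x
    by_cases h : fail E = 0
    · have : fail (x :: E) = 0 := le_antisymm ((hfail' E x).trans h.le) bot_le
      simp [F, h, this]
    · refine (mono j (hits E) _ (hh E x)).trans ?_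
      simp [F, h]
  suffices (greedyRounds far m j E).lexp fail ≤ F j E from this.trans (hF j E)
  induction j generalizing E with
  | zero =>
    simp only [greedyRounds, PMF.lexp_pure]
    by_cases h : fail E = 0
    · simp [F, h]
    · refine (hfail E).trans ?_
      simp only [F, h, if_false, pow_zero, mul_one]
      rw [← ENNReal.ofReal_one]
      -- Markov's inequality: at failure `hits E ≤ K - 1`, so the potential is at least 1.
      refine ENNReal.ofReal_le_ofReal (Real.one_le_exp (mul_nonneg hs ?_))
      have : (hits E : ℝ) + 1 ≤ K := by exact_mod_cast hK E h
      linarith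
  | succ j ih =>
    simp only [greedyRounds, PMF.lexp_bind]
    refine (PMF.lexp_mono _ ih).trans ?_
    by_cases h : fail E = 0
    · refine (lexp_drawFrom_le_self _ _ (anti j) _ _).trans ?_
      simp [F, h]
    · obtain ⟨G, hG, hGη, hGh⟩ := hstep E h
      have hexp : Real.exp (s * (K - 1 - (hits E + 1 : ℕ))) =
          Real.exp (-s) * Real.exp (s * (K - 1 - hits E)) := by
        rw [← Real.exp_add]; push_cast; ring_nf
      -- Here `b` bounds the potential after a new hit, and `b + c` is its value without one, so `b
      -- + η c` is the old potential with `j + 1` rounds to go.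
      refine (lexp_drawFrom_le (far E) G hG (hQ E) (F j) (anti j) hGη
        (b := ENNReal.ofReal (Real.exp (s * (K - 1 - (hits E + 1 : ℕ))) * q ^ j))
        (c := ENNReal.ofReal ((1 - Real.exp (-s)) * Real.exp (s * (K - 1 - hits E)) * q ^ j))
        (fun E' hE' x hx => mono j _ _ (hGh E' hE' x hx)) ?_).trans_eq ?_
      · rw [← ENNReal.ofReal_add (by positivity) (by positivity), hexp]
        refine (hF j E).trans_eq ?_
        congr 1; ring
      · rw [← ENNReal.ofReal_mul hη, ← ENNReal.ofReal_add (by positivity) (by positivity), hexp]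
        simp only [F, h, if_false]
        congr 1
        rw [pow_succ', hq]; ring

/-- With `s = 1 / (2√κ)`, the `√κ` extra expected hits contribute `-s√κ = -1/2` to the exponent,
while the second-order error is about `s²κ/2 = 1/8`. The sum stays below `-1/4`. The term `K - 2`
reflects one hit by the initial sample. -/
theorem exp_mul_pow_le {κ K η : ℝ} {j : ℕ} (hκ : 1 ≤ κ) (hK : K ≤ κ) (hη : 0 < η) (hη1 : η < 1)
    (hj : κ + √κ ≤ (1 - η) * (j + 1)) :
    Real.exp (1 / (2 * √κ) * (K - 2)) *
      (Real.exp (-(1 / (2 * √κ))) + η * (1 - Real.exp (-(1 / (2 * √κ))))) ^ j ≤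
      Real.exp (-((1 - η) / 4)) := by
  have hr : 1 ≤ √κ := Real.one_le_sqrt.2 hκ
  have hr2 : √κ * √κ = κ := Real.mul_self_sqrt (by linarith)
  generalize √κ = r at *
  set s : ℝ := 1 / (2 * r) with hs
  have hs0 : 0 < s := by positivity
  have hsr : s * r = 1 / 2 := by rw [hs]; field_simp
  have hs1 : s ≤ 1 / 2 := by nlinarith
  have hexp : Real.exp (-s) ≤ 1 - s + s ^ 2 / 2 := by
    have h1 := Real.quadratic_le_exp_of_nonneg hs0.le
    have h2 : Real.exp (-s) * Real.exp s = 1 := by rw [← Real.exp_add]; simp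
    have h3 : 0 ≤ 1 - s + s ^ 2 / 2 := by nlinarith
    -- The product `(1 - s + s²/2)(1 + s + s²/2)` equals `1 + s⁴/4`, hence is at least 1.
    calc Real.exp (-s) = Real.exp (-s) * 1 := (mul_one _).symm
      _ ≤ Real.exp (-s) * ((1 - s + s ^ 2 / 2) * (1 + s + s ^ 2 / 2)) := by
          gcongr
          nlinarith [sq_nonneg (s ^ 2)]
      _ ≤ Real.exp (-s) * ((1 - s + s ^ 2 / 2) * Real.exp s) := by gcongr
      _ = 1 - s + s ^ 2 / 2 := by rw [mul_left_comm, h2, mul_one]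
  have hq : Real.exp (-s) + η * (1 - Real.exp (-s)) ≤
      Real.exp (-((1 - η) * (s - s ^ 2 / 2))) := by
    refine le_trans ?_ (Real.add_one_le_exp _)
    nlinarith
  have hq0 : 0 ≤ Real.exp (-s) + η * (1 - Real.exp (-s)) := by
    have := Real.exp_pos (-s)
    nlinarith
  calc _ ≤ Real.exp (s * (K - 2)) * Real.exp (-((1 - η) * (s - s ^ 2 / 2))) ^ j := by gcongr
    _ = Real.exp (s * (K - 2) - ((1 - η) * j) * (s - s ^ 2 / 2)) := by
        rw [← Real.exp_nat_mul, ← Real.exp_add]; ring_nf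
    _ ≤ _ := by
        apply Real.exp_le_exp.2
        have h1 : 0 ≤ s - s ^ 2 / 2 := by nlinarith
        have h2 : κ + r - 1 ≤ (1 - η) * j := by linarith
        have h3 := mul_le_mul_of_nonneg_right h2 h1
        have h4 : s * (K - 2) ≤ s * (κ - 2) := by gcongr
        have h5 : s ^ 2 * κ = 1 / 4 := by
          rw [← hr2, show s ^ 2 * (r * r) = (s * r) ^ 2 by ring, hsr]; norm_num
        have h6 : s ^ 2 * r = s / 2 := by rw [pow_two, mul_assoc, hsr]; ring
        nlinarith

/-! ### Half-radius covers and the success probability -/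

section Quality

variable {X : Type u} [Fintype X] [MetricSpace X]

theorem clusterCost_ne_top {X : Type u} [MetricSpace X] {k : ℕ} (hk : 0 < k) (S : Finset X) (c : Fin k → X) :
    clusterCost S (Set.range c) ≠ ⊤ := by
  unfold clusterCost
  rw [← Finset.sup_eq_iSup, ← lt_top_iff_ne_top, Finset.sup_lt_iff bot_lt_top]
  intro p _
  exact (Metric.infEDist_le_edist_of_mem (Set.mem_range_self ⟨0, hk⟩)).trans_lt (edist_lt_top _ _)

theorem infEDist_le_optRadius {k z : ℕ} {S : Finset X} {c : Fin k → X}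
    (h : IsOptimalSolution k z S c) {p : X} (hp : p ∈ S) :
    Metric.infEDist p (Set.range c) ≤ optRadius X k z := by
  rw [← h.cost_eq]
  exact le_iSup₂ (f := fun p (_ : p ∈ S) => Metric.infEDist p (Set.range c)) p hp

/-- The inliers are covered by `2 ^ ρ k` balls of half the optimal radius. -/
theorem exists_half_radius_cover {k z : ℕ} {S : Finset X} {c : Fin k → X} {ρ : ℝ} (hk : 0 < k)
    (h : IsOptimalSolution k z S c) (hd : DoublingDimLE S ρ) :
    ∃ B : Finset X, (B.card : ℝ) ≤ (2 : ℝ) ^ ρ * k ∧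
      ∀ p ∈ S, ∃ b ∈ B, edist p b ≤ optRadius X k z / 2 := by
  classical
  have hr : optRadius X k z ≠ ⊤ := h.cost_eq ▸ clusterCost_ne_top hk S c
  set r := (optRadius X k z).toReal with hrdef
  have hr0 : 0 ≤ r := ENNReal.toReal_nonneg
  have hrof : optRadius X k z = ENNReal.ofReal r := (ENNReal.ofReal_toReal hr).symm
  -- Doubling is assumed only inside `S`; it applies because the centers are inliers.
  choose B hB hcov using fun j => hd ⟨c j, h.center_mem j⟩ (r / 2) (by positivity)
  refine ⟨Finset.univ.biUnion fun j => (B j).image Subtype.val, ?_, ?_⟩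
  · calc (((Finset.univ.biUnion fun j => (B j).image Subtype.val).card : ℕ) : ℝ)
        ≤ ((∑ j, ((B j).image Subtype.val).card : ℕ) : ℝ) := by
          exact_mod_cast Finset.card_biUnion_le
      _ ≤ ∑ _j : Fin k, (2 : ℝ) ^ ρ := by
          push_cast
          gcongr with j
          exact le_trans (by exact_mod_cast Finset.card_image_le) (hB j)
      _ = (2 : ℝ) ^ ρ * k := by simp [mul_comm]
  · intro p hp
    obtain ⟨y, ⟨j, rfl⟩, hj⟩ := (Set.finite_range c).isCompact.exists_infEDist_eq_edist
      ⟨_, Set.mem_range_self ⟨0, hk⟩⟩ p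
    have hle : edist p (c j) ≤ ENNReal.ofReal r := by
      rw [← hj, ← hrof]; exact infEDist_le_optRadius h hp
    rw [edist_dist, ENNReal.ofReal_le_ofReal_iff hr0] at hle
    have := hcov j (show (⟨p, hp⟩ : S) ∈ Metric.closedBall _ _ by
      rw [Metric.mem_closedBall, Subtype.dist_eq]; linarith)
    simp only [Set.mem_iUnion] at this
    obtain ⟨b, hb, hpb⟩ := this
    refine ⟨b, Finset.mem_biUnion.2 ⟨j, Finset.mem_univ _, Finset.mem_image_of_mem _ hb⟩, ?_⟩
    rw [Metric.mem_closedBall, Subtype.dist_eq] at hpb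
    rw [hrof, edist_dist, show (2 : ℝ≥0∞) = ENNReal.ofReal 2 by simp,
      ← ENNReal.ofReal_div_of_pos two_pos]
    exact ENNReal.ofReal_le_ofReal hpb

theorem phi_le_of_forall {z : ℕ} {ε : ℝ} {A : Set X} {r : ℝ≥0∞} (S : Finset X)
    (hS : (Fintype.card X : ℝ) - (1 + ε) * z ≤ S.card) (h : ∀ p ∈ S, Metric.infEDist p A ≤ r) :
    phi z ε A ≤ r :=
  (iInf₂_le S hS).trans (iSup₂_le h)

open Classical in
theorem phi_le_of_card_far_le {z : ℕ} {ε : ℝ} {A : Set X} {r : ℝ≥0∞}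
    (h : ((Finset.univ.filter fun x => r < Metric.infEDist x A).card : ℝ) ≤ (1 + ε) * z) :
    phi z ε A ≤ r := by
  refine phi_le_of_forall (Finset.univ.filter fun x => ¬ r < Metric.infEDist x A) ?_ ?_
  · have := Finset.card_filter_add_card_filter_not (s := Finset.univ)
      (fun x => r < Metric.infEDist x A)
    rw [Finset.card_univ] at this
    rw [← this]
    push_cast
    linarith
  · intro p hp
    simpa using hp

theorem phi_anti {z : ℕ} {ε : ℝ} {A A' : Set X} (h : A ⊆ A') : phi z ε A' ≤ phi z ε A :=
  iInf₂_mono fun _ _ => iSup₂_mono fun _ _ => Metric.infEDist_anti h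

open Classical in
/-- If the centers `E` are not yet good enough, then the farthest vertices are all far from `E`,
and a large part of them consists of inliers. -/
theorem IsFarthest.far_of_lt_phi {z : ℕ} {ε : ℝ} {E : Set X} {Q S : Finset X} {r : ℝ≥0∞}
    (hz : 0 < z) (hε : 0 < ε) (hQ : IsFarthest (farCount z ε) E Q)
    (hS : Fintype.card X ≤ S.card + z) (h : r < phi z ε E) :
    (∀ x ∈ Q, r < Metric.infEDist x E) ∧
      ε / (1 + ε) ≤ ((Q.filter (· ∈ S)).card : ℝ) / Q.card := by
  set F := Finset.univ.filter fun x => r < Metric.infEDist x E with hF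
  have hFc : (1 + ε) * z < F.card := by
    by_contra hcon
    exact (phi_le_of_card_far_le (not_lt.1 hcon)).not_gt h
  have hq : farCount z ε ≤ F.card := Nat.ceil_le.2 hFc.le
  have hQc : Q.card = farCount z ε := by
    rw [hQ.1, min_eq_left (hq.trans (Finset.card_le_univ _))]
  have hqz : (1 + ε) * z ≤ farCount z ε := Nat.le_ceil _
  have hz' : (0 : ℝ) < z := by exact_mod_cast hz
  constructor
  · intro x hx
    by_contra hxr
    -- A vertex `x ∈ Q` within `r` of `E` would force all far vertices into `Q` without `x`, but
    -- there are at least `Q.card` of them.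
    have hsub : F ⊆ Q.erase x := by
      intro y hy
      have hy' : r < Metric.infEDist y E := by simpa [hF] using hy
      refine Finset.mem_erase.2 ⟨?_, ?_⟩
      · rintro rfl; exact hxr hy'
      · by_contra hyQ
        exact hxr (hy'.trans_le (hQ.2 x hx y hyQ))
    have h1 := Finset.card_le_card hsub
    rw [Finset.card_erase_of_mem hx] at h1
    have := Finset.card_pos.2 ⟨x, hx⟩
    omega
  · have h1 : (Q.filter (· ∈ S)).card + (Q.filter (¬ · ∈ S)).card = Q.card :=
      Finset.card_filter_add_card_filter_not _
    have h2 : (Q.filter (¬ · ∈ S)).card ≤ z := by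
      have h3 : (Q.filter (¬ · ∈ S)).card ≤ Sᶜ.card :=
        Finset.card_le_card fun x hx => by simpa using (Finset.mem_filter.1 hx).2
      rw [Finset.card_compl] at h3
      omega
    have h3 : (Q.card : ℝ) ≤ (Q.filter (· ∈ S)).card + z := by
      rw [← h1]; push_cast; gcongr
    have h4 : 0 < (Q.card : ℝ) := by rw [hQc]; exact lt_of_lt_of_le (by positivity) hqz
    rw [← hQc] at hqz
    rw [div_le_div_iff₀ (by linarith) h4]
    nlinarith

open Classical in
-- The failure probability is at most `e` once the initial sample contains an inlier, and trivially
-- at most `1 = e + (1 - e)` otherwise, which has probability at most `η`.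
theorem lexp_biCriteria_le {k z : ℕ} {ε η ρ : ℝ} {S : Finset X} {c : Fin k → X}
    (hη : 0 < η) (hη1 : η < 1) (hk : 0 < k) (hz : 0 < z) (hzn : z < Fintype.card X) (hε : 0 < ε)
    (hρ : 0 < ρ) (hopt : IsOptimalSolution k z S c) (hd : DoublingDimLE S ρ)
    {far : List X → Finset X} (hfar : IsFarthestRule (farCount z ε) far) :
    ((biCriteria z ε η (doublingRounds k ρ η) far).lexp fun E =>
      if phi z ε {x | x ∈ E} ≤ optRadius X k z then 0 else 1) ≤
    ENNReal.ofReal (Real.exp (-((1 - η) / 4))) +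
      ENNReal.ofReal η * ENNReal.ofReal (1 - Real.exp (-((1 - η) / 4))) := by
  obtain ⟨B, hBcard, hB⟩ := exists_half_radius_cover hk hopt hd
  have hz' : (0 : ℝ) < z := by exact_mod_cast hz
  have hn' : (0 : ℝ) < Fintype.card X := by exact_mod_cast (hz.trans hzn)
  have hzn' : (z : ℝ) < Fintype.card X := by exact_mod_cast hzn
  have hScard : Fintype.card X = S.card + z := by rw [hopt.card_eq]; omega
  set r := optRadius X k z with hr
  set e := Real.exp (-((1 - η) / 4)) with he
  have he1 : e ≤ 1 := Real.exp_le_one_iff.2 (by linarith)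
  have he0 : 0 ≤ e := (Real.exp_pos _).le
  set fail : List X → ℝ≥0∞ := fun E =>
    if phi z ε {x | x ∈ E} ≤ r then 0 else 1 with hfaildef
  have hfail0 : ∀ E, fail E ≠ 0 → r < phi z ε {x | x ∈ E} := by
    intro E hE
    by_contra hcon
    exact hE (if_pos (not_lt.1 hcon))
  have hfail1 : ∀ E, fail E ≤ 1 := by
    intro E; simp only [hfaildef]; split_ifs <;> simp
  have hfailanti : ∀ E x, fail (x :: E) ≤ fail E := by
    intro E x
    by_cases h : phi z ε {x | x ∈ E} ≤ r
    · have : phi z ε {y | y ∈ x :: E} ≤ r :=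
        (phi_anti fun y hy => List.mem_cons_of_mem _ hy).trans h
      simp only [hfaildef, if_pos h, if_pos this, le_refl]
    · exact (hfail1 _).trans (by simp [hfaildef, h])
  -- The half-balls that are hit; their number is the counter of the tail bound.
  let H : List X → Finset X := fun E => B.filter fun b => ∃ x ∈ E, x ∈ S ∧ edist x b ≤ r / 2
  have hHmono : ∀ E E', E ⊆ E' → H E ⊆ H E' := fun E E' hE b hb => by
    obtain ⟨hb, x, hx, h⟩ := Finset.mem_filter.1 hb
    exact Finset.mem_filter.2 ⟨hb, x, hE hx, h⟩
  have hHnear : ∀ E b p, b ∈ H E → edist p b ≤ r / 2 → Metric.infEDist p {x | x ∈ E} ≤ r := by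
    intro E b p hb hp
    obtain ⟨_, x, hx, _, hxb⟩ := Finset.mem_filter.1 hb
    refine (Metric.infEDist_le_edist_of_mem (show x ∈ {x | x ∈ E} from hx)).trans ?_
    calc edist p x ≤ edist p b + edist x b := edist_triangle_right _ _ _
      _ ≤ r / 2 + r / 2 := add_le_add hp hxb
      _ = r := ENNReal.add_halves r
  have hQ : ∀ E, (far E).Nonempty := by
    intro E
    rw [← Finset.card_pos, (hfar E).1]
    refine lt_min ?_ (hz.trans hzn)
    exact Nat.ceil_pos.2 (by positivity)
  have hround : ∀ (E : List X), (∃ x ∈ E, x ∈ S) →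
      (greedyRounds far (roundSamples ε η) (doublingRounds k ρ η - 1) E).lexp fail ≤
        ENNReal.ofReal e := by
    intro E ⟨x, hxE, hxS⟩
    refine (lexp_greedyRounds_le far (roundSamples ε η) B.card hη.le
      (s := 1 / (2 * √((2 : ℝ) ^ ρ * k))) (by positivity) (fun E => (H E).card) fail
      (fun E x => Finset.card_le_card (hHmono _ _ (List.subset_cons_self _ _)))
      hfail1 hfailanti ?_ hQ ?_ _ E).trans ?_
    · intro E hE
      refine Finset.card_lt_card ((Finset.filter_subset _ _).ssubset_of_ne fun hEB => ?_)
      -- If every half-ball were hit, all inliers would be within `r` of `E`.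
      refine (hfail0 E hE).not_ge (phi_le_of_forall S ?_ ?_)
      · rw [hScard]; push_cast; nlinarith
      · intro p hp
        obtain ⟨b, hb, hpb⟩ := hB p hp
        exact hHnear E b p (by rw [← hEB] at hb; exact hb) hpb
    · intro E hE
      obtain ⟨h1, h2⟩ := (hfar E).far_of_lt_phi hz hε hScard.le (hfail0 E hE)
      refine ⟨(far E).filter (· ∈ S), Finset.filter_subset _ _, ?_, ?_⟩
      · refine one_sub_pow_le (x := ε / (1 + ε)) (by positivity) hη ?_ h2 ?_
        · rw [one_div_div]; exact Nat.le_ceil _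
        · have : (0 : ℝ) < (far E).card := by exact_mod_cast (hQ E).card_pos
          rw [div_le_one this]
          exact_mod_cast Finset.card_filter_le _ _
      · intro E' hE' x hx
        obtain ⟨hxQ, hxS⟩ := Finset.mem_filter.1 hx
        -- The half-ball of `x` was not hit at the start of the round, since `x` is farther than `r`
        -- from `E`. Vertices drawn in between can only add hits.
        obtain ⟨b, hb, hxb⟩ := hB x hxS
        refine Finset.card_lt_card ((Finset.ssubset_iff_of_subset
          (hHmono _ _ (List.Subset.trans hE' (List.subset_cons_self _ _)))).2 ⟨b, ?_, fun hbE => ?_⟩)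
        · exact Finset.mem_filter.2 ⟨hb, x, List.mem_cons_self, hxS, hxb⟩
        · exact (h1 x hxQ).not_ge (hHnear E b x hbE hxb)
    · apply ENNReal.ofReal_le_ofReal
      -- The initial inlier already hits one half-ball, which turns `K - 1 - hits` into at most `K -
      -- 2`.
      have hH : (1 : ℝ) ≤ (H E).card := by
        obtain ⟨b, hb, hxb⟩ := hB x hxS
        have : 0 < (H E).card :=
          Finset.card_pos.2 ⟨b, Finset.mem_filter.2 ⟨hb, x, hxE, hxS, hxb⟩⟩
        exact_mod_cast this
      have hκ : 1 ≤ (2 : ℝ) ^ ρ * k := by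
        have h1 : 1 ≤ (2 : ℝ) ^ ρ := Real.one_le_rpow one_le_two hρ.le
        have h2 : (1 : ℝ) ≤ k := by exact_mod_cast hk
        nlinarith
      have hsqrt : (2 : ℝ) ^ (ρ / 2) * √k = √((2 : ℝ) ^ ρ * k) := by
        rw [Real.sqrt_mul (by positivity), Real.sqrt_eq_rpow ((2 : ℝ) ^ ρ),
          ← Real.rpow_mul (by norm_num)]
        ring_nf
      have ht : ((2 : ℝ) ^ ρ * k + √((2 : ℝ) ^ ρ * k)) / (1 - η) ≤ doublingRounds k ρ η := by
        rw [← hsqrt]; exact Nat.le_ceil _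
      have ht0 : 0 < doublingRounds k ρ η := by
        have : (0 : ℝ) < doublingRounds k ρ η :=
          lt_of_lt_of_le (div_pos (by positivity) (by linarith)) ht
        exact_mod_cast this
      rw [div_le_iff₀ (by linarith)] at ht
      refine le_trans ?_ (exp_mul_pow_le (K := B.card) (j := doublingRounds k ρ η - 1) hκ hBcard
        hη hη1 ?_)
      · have h0 : 0 ≤ 1 / (2 * √((2 : ℝ) ^ ρ * k)) := by positivity
        generalize 1 / (2 * √((2 : ℝ) ^ ρ * k)) = s at *
        have h1 : Real.exp (-s) ≤ 1 := Real.exp_le_one_iff.2 (by linarith)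
        have h2 := Real.exp_pos (-s)
        have : 0 ≤ Real.exp (-s) + η * (1 - Real.exp (-s)) := by nlinarith
        gcongr ?_ * _
        apply Real.exp_le_exp.2
        have h3 : (B.card : ℝ) - 1 - (H E).card ≤ B.card - 2 := by linarith
        gcongr
      · rw [Nat.cast_sub ht0]; push_cast; linarith
  let f : List X → ℝ≥0∞ := fun E => if ∃ x ∈ E, x ∈ S then ENNReal.ofReal e else 1
  have hle1 : ENNReal.ofReal e ≤ 1 := ENNReal.ofReal_le_one.2 he1
  have hf1 : ∀ E, f E ≤ 1 := by intro E; simp only [f]; split_ifs <;> simp [hle1]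
  have hgf : ∀ E, (greedyRounds far (roundSamples ε η) (doublingRounds k ρ η - 1) E).lexp fail
      ≤ f E := by
    intro E
    by_cases h : ∃ x ∈ E, x ∈ S
    · simpa only [f, if_pos h] using hround E h
    · simp only [f, if_neg h]
      exact (PMF.lexp_mono _ hfail1).trans (by simp)
  have huniv : (Finset.univ : Finset X).Nonempty :=
    Finset.card_pos.1 (by rw [Finset.card_univ]; omega)
  have hfrac : (S.card : ℝ) / (Finset.univ : Finset X).card = 1 - (z : ℝ) / Fintype.card X := by
    rw [Finset.card_univ, one_sub_div hn'.ne']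
    congr 1
    rw [hScard]; push_cast; ring
  have hγ : (z : ℝ) / Fintype.card X < 1 := (div_lt_one hn').2 hzn'
  have hγ0 : 0 < (z : ℝ) / Fintype.card X := by positivity
  rw [biCriteria, PMF.lexp_bind]
  refine (PMF.lexp_mono _ hgf).trans
    (lexp_drawFrom_le Finset.univ S (Finset.subset_univ _) huniv f ?_ ?_ ?_ ?_)
  · intro E x
    by_cases h : ∃ x ∈ E, x ∈ S
    · have : ∃ y ∈ x :: E, y ∈ S := h.imp fun y hy => ⟨List.mem_cons_of_mem _ hy.1, hy.2⟩
      simp only [f, if_pos h, if_pos this, le_refl]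
    · exact (hf1 _).trans (by simp only [f, if_neg h, le_refl])
  · rw [hfrac]
    exact one_sub_pow_le (x := 1 - (z : ℝ) / Fintype.card X) (by linarith) hη (Nat.le_ceil _)
      le_rfl (by linarith)
  · intro E' _ x hx
    have : ∃ y ∈ x :: E', y ∈ S := ⟨x, List.mem_cons_self, hx⟩
    simp only [f, if_pos this, le_refl]
  · rw [← ENNReal.ofReal_add he0 (by linarith)]
    simpa using hf1 []

theorem biCriteria_quality {k z : ℕ} {ε η ρ : ℝ} {S : Finset X} {c : Fin k → X}
    (hη : 0 < η) (hη1 : η < 1) (hk : 0 < k) (hz : 0 < z) (hzn : z < Fintype.card X) (hε : 0 < ε)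
    (hρ : 0 < ρ) (hopt : IsOptimalSolution k z S c) (hd : DoublingDimLE S ρ)
    {far : List X → Finset X} (hfar : IsFarthestRule (farCount z ε) far) :
    ENNReal.ofReal ((1 - η) * (1 - Real.exp (-((1 - η) / 4)))) ≤
      (biCriteria z ε η (doublingRounds k ρ η) far).toOuterMeasure
        {E | phi z ε {x | x ∈ E} ≤ optRadius X k z} := by
  classical
  refine le_trans (le_of_eq ?_) (PMF.one_sub_le_toOuterMeasure _ _
    (by convert lexp_biCriteria_le hη hη1 hk hz hzn hε hρ hopt hd hfar; rfl))
  have he1 : Real.exp (-((1 - η) / 4)) ≤ 1 := Real.exp_le_one_iff.2 (by linarith)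
  have he0 := (Real.exp_pos (-((1 - η) / 4))).le
  generalize Real.exp (-((1 - η) / 4)) = e at *
  have h1 : 0 ≤ η * (1 - e) := mul_nonneg hη.le (by linarith)
  rw [← ENNReal.ofReal_mul hη.le, ← ENNReal.ofReal_add he0 h1, ← ENNReal.ofReal_one,
    ← ENNReal.ofReal_sub _ (by positivity)]
  congr 1; ring

end Quality

/-! ### The law of the program -/

theorem map_value_bindTimed {α : Type u} {β : Type v} (x : PMF (Timed α))
    (f : α → PMF (Timed β)) :
    (bindTimed x f).map Timed.value = (x.map Timed.value).bind fun a => (f a).map Timed.value := by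
  rw [bindTimed, PMF.map_bind, PMF.bind_map]
  simp only [PMF.map_comp]
  rfl

theorem mem_support_bindTimed {α : Type u} {β : Type v} {x : PMF (Timed α)}
    {f : α → PMF (Timed β)} {o : Timed β} (h : o ∈ (bindTimed x f).support) :
    ∃ a ∈ x.support, ∃ b ∈ (f a.value).support, o.value = b.value ∧
      o.steps = a.steps + b.steps := by
  rw [bindTimed, PMF.mem_support_bind_iff] at h
  obtain ⟨a, ha, h⟩ := h
  rw [PMF.mem_support_map_iff] at h
  obtain ⟨b, hb, rfl⟩ := h
  exact ⟨a, ha, b, hb, rfl, rfl⟩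

theorem mem_support_bindTimed_pure {α : Type u} {β : Type v} {x : Timed α}
    {f : α → PMF (Timed β)} {o : Timed β} (h : o ∈ (bindTimed (PMF.pure x) f).support) :
    ∃ b ∈ (f x.value).support, o.value = b.value ∧ o.steps = x.steps + b.steps := by
  obtain ⟨a, ha, h⟩ := mem_support_bindTimed h
  rw [PMF.mem_support_pure_iff] at ha
  exact ha ▸ h

open Classical in
-- Without duplicates, indexing is a bijection from positions to elements. This passes from the
-- random index of the program to the random vertex of the algorithm.
theorem uniformOfFinset_range_bind {X : Type u} {β : Type v} (Q : List X) (hQ : Q.Nodup)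
    (h : (Finset.range Q.length).Nonempty) (h' : Q.toFinset.Nonempty) (F : ℕ → PMF β)
    (G : X → PMF β) (hFG : ∀ i (hi : i < Q.length), F i = G Q[i]) :
    (PMF.uniformOfFinset (Finset.range Q.length) h).bind F =
      (PMF.uniformOfFinset Q.toFinset h').bind G := by
  ext y
  rw [PMF.bind_apply, PMF.bind_apply]
  change PMF.lexp _ (fun i => F i y) = PMF.lexp _ (fun x => G x y)
  rw [PMF.lexp_uniformOfFinset, PMF.lexp_uniformOfFinset, List.toFinset_card_of_nodup hQ,
    Finset.card_range, List.sum_toFinset _ hQ, Finset.sum_range, ← Fin.sum_univ_fun_getElem]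
  simp only [hFG _ (Fin.is_lt _)]

section Implementation

variable {X : Type u} [MetricSpace X]

/-- The table of the distances of the vertices `vs` to the centers `E`. -/
noncomputable def distTable (vs E : List X) : List (X × ℝ≥0∞) :=
  vs.map fun x => (x, Metric.infEDist x {y | y ∈ E})

theorem updateTable_distTable (vs E : List X) (x : X) :
    (updateTable x (distTable vs E)).value = distTable vs (x :: E) := by
  rw [updateTable, Timed.mapList_value, distTable, distTable, List.map_map]
  refine List.map_congr_left fun a _ => ?_
  have : {y | y ∈ x :: E} = {x} ∪ {y | y ∈ E} := by ext y; simp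
  rw [this, Metric.infEDist_union, Metric.infEDist_singleton]
  rfl

open Classical in
/-- The tie-breaking rule of the program. -/
noncomputable def programFar (vs : List X) (q : ℕ) (E : List X) : Finset X :=
  (Timed.largest q (distTable vs E)).value.toFinset

theorem isFarthestRule_programFar [Fintype X] {vs : List X} (hvs : vs.Nodup) (hmem : ∀ x, x ∈ vs)
    {q : ℕ} (hq : 0 < q) : IsFarthestRule q (programFar vs q) := by
  classical
  intro E
  obtain ⟨h1, h2, _, h4⟩ := Timed.largest_map_value_spec hq hvs
    (fun x => Metric.infEDist x {y | y ∈ E})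
  have hlen : vs.length = Fintype.card X := by
    rw [← List.toFinset_card_of_nodup hvs, ← Finset.card_univ]
    congr 1
    ext x; simp [hmem x]
  constructor
  · rw [programFar, distTable, List.toFinset_card_of_nodup h1, ← hlen]
    exact h2
  · intro x hx y hy
    exact h4 x (List.mem_toFinset.1 hx) y (hmem y) fun h => hy (List.mem_toFinset.2 h)

open Classical in
-- The invariant is that the table always holds the distances to the current `E`. If `Q` is empty,
-- both sides stop without a draw.
theorem map_value_drawProgram (vs Q : List X) (hQ : Q.Nodup) (m : ℕ) (E : List X) :
    (drawProgram Q Q.length m (E, distTable vs E)).map Timed.value =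
      (drawFrom Q.toFinset m E).map fun E' => (E', distTable vs E') := by
  induction m generalizing E with
  | zero => simp [drawProgram, drawFrom, PMF.pure_map]
  | succ m ih =>
    simp only [drawProgram, map_value_bindTimed, PMF.pure_map, PMF.pure_bind,
      Timed.charge_value, Timed.nth_value]
    by_cases h : Q = []
    · subst h
      simp [randomIndex, drawFrom, PMF.pure_map]
    · have h1 : (Finset.range Q.length).Nonempty := by
        simpa [Finset.nonempty_range_iff] using h
      have h2 : Q.toFinset.Nonempty := by simpa [List.toFinset_nonempty_iff] using h
      have h3 : (randomIndex Q.length).map Timed.value = PMF.uniformOfFinset _ h1 := by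
        rw [randomIndex, dif_pos h1, PMF.map_comp]
        exact PMF.map_id _
      rw [h3]
      simp only [drawFrom, dif_pos h2, PMF.map_bind]
      refine uniformOfFinset_range_bind Q hQ h1 h2 _ _ fun i hi => ?_
      simp only [List.getElem?_eq_getElem hi, map_value_bindTimed, PMF.pure_map, PMF.pure_bind, updateTable_distTable]
      exact ih _

theorem map_value_roundsProgram {vs : List X} (hvs : vs.Nodup) {q : ℕ} (hq : 0 < q)
    (m j : ℕ) (E : List X) :
    (roundsProgram q m j (E, distTable vs E)).map Timed.value =
      greedyRounds (programFar vs q) m j E := by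
  induction j generalizing E with
  | zero => simp [roundsProgram, greedyRounds, PMF.pure_map]
  | succ j ih =>
    have hnd : (Timed.largest q (distTable vs E)).value.Nodup :=
      (Timed.largest_map_value_spec hq hvs _).1
    simp only [roundsProgram, map_value_bindTimed, PMF.pure_map, PMF.pure_bind,
      Timed.charge_value, Timed.len_value, greedyRounds]
    rw [map_value_drawProgram vs _ hnd, PMF.bind_map]
    congr 1
    funext E'
    exact ih E'

theorem map_value_biCriteriaProgram [Fintype X] {vs : List X} (hvs : vs.Nodup)
    (hmem : ∀ x, x ∈ vs) {z : ℕ} {ε η : ℝ} {q : ℕ} (hq : 0 < q) (t : ℕ) :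
    (biCriteriaProgram vs (initialSamples (Fintype.card X) z η) q (roundSamples ε η) t).map
      Timed.value = biCriteria z ε η t (programFar vs q) := by
  classical
  -- The distance to the empty set is `⊤`, so the invariant holds initially.
  have htbl : vs.map (fun x => (x, (⊤ : ℝ≥0∞))) = distTable vs [] := by
    simp [distTable]
  have huniv : vs.toFinset = Finset.univ := by ext x; simp [hmem x]
  simp only [biCriteriaProgram, biCriteria, map_value_bindTimed, PMF.pure_map, PMF.pure_bind,
    Timed.len_value, Timed.mapList_value]
  rw [htbl, map_value_drawProgram vs vs hvs, PMF.bind_map, huniv]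
  congr 1
  funext E
  exact map_value_roundsProgram hvs hq _ _ E

/-! ### The number of steps -/

theorem steps_of_mem_support_randomIndex {n : ℕ} {o : Timed ℕ} (h : o ∈ (randomIndex n).support) :
    o.steps = 1 := by
  unfold randomIndex at h
  split_ifs at h
  · rw [PMF.mem_support_map_iff] at h
    obtain ⟨i, _, rfl⟩ := h
    rfl
  · rw [PMF.mem_support_pure_iff] at h
    rw [h]

/-- One draw costs 1 for the index, at most `2|Q| + 3` for the access and `4|table| + 1` for the
update. -/
theorem steps_drawProgram_le (Q : List X) (n m : ℕ) (s : List X × List (X × ℝ≥0∞))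
    {o : Timed (List X × List (X × ℝ≥0∞))} (h : o ∈ (drawProgram Q n m s).support) :
    o.steps ≤ 1 + m * (2 * Q.length + 4 * s.2.length + 5) ∧ o.value.2.length = s.2.length := by
  induction m generalizing s o with
  | zero =>
    rw [drawProgram, PMF.mem_support_pure_iff] at h
    simp [h]
  | succ m ih =>
    rw [drawProgram] at h
    obtain ⟨i, hi, b, hb, hv, hs⟩ := mem_support_bindTimed h
    obtain ⟨b', hb', hv', hs'⟩ := mem_support_bindTimed_pure hb
    have h1 := steps_of_mem_support_randomIndex hi
    have h2 := Timed.nth_steps_le Q i.value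
    rw [Timed.charge_steps] at hs'
    rw [hv, hv', add_mul, one_mul]
    split at hb'
    · rw [PMF.mem_support_pure_iff] at hb'
      subst hb'
      exact ⟨by dsimp only at hs'; omega, rfl⟩
    · next x _ =>
      obtain ⟨b'', hb'', hv'', hs''⟩ := mem_support_bindTimed_pure hb'
      obtain ⟨h3, h4⟩ := ih _ hb''
      have h5 : (updateTable x s.2).value.length = s.2.length := by simp [updateTable]
      have h6 : (updateTable x s.2).steps = 4 * s.2.length + 1 := by simp [updateTable]
      dsimp only at h3 h4
      rw [h5] at h3 h4
      exact ⟨by omega, by rw [hv'', h4]⟩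

/-- A crude bound, valid for arbitrary tables: the strictly larger items and the ties are counted
separately. Only the constant suffers. -/
theorem Timed.largest_length_le {K : Type v} [LinearOrder K] [Inhabited K] {α : Type u} (q : ℕ)
    (l : List (α × K)) : (Timed.largest q l).value.length ≤ 2 * l.length := by
  by_cases h : l.length ≤ q
  · simp [Timed.largest, h]; omega
  · simp only [Timed.largest, h, if_false, charge_value, bind_value, len_value,
      mapList_value, aboveAndTies_value, appendList_value, takeList_value, List.length_append,
      List.length_take, List.length_map]
    set v := (selectNth l.length (l.map Prod.snd) (q - 1)).value
    have h2 := List.length_filter_le (fun a : α × K => decide (v < a.2)) l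
    have h3 := List.length_filter_le (fun a : α × K => decide (a.2 = v)) l
    omega

theorem steps_roundsProgram_le {q : ℕ} (hq : 0 < q) (m j : ℕ) (s : List X × List (X × ℝ≥0∞))
    {o : Timed (List X)} (h : o ∈ (roundsProgram q m j s).support) :
    o.steps ≤ 1 + j * (2024 * s.2.length + 123 + m * (8 * s.2.length + 5)) := by
  induction j generalizing s o with
  | zero =>
    rw [roundsProgram, PMF.mem_support_pure_iff] at h
    simp [h]
  | succ j ih =>
    rw [roundsProgram] at h
    obtain ⟨b, hb, -, hs⟩ := mem_support_bindTimed_pure h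
    obtain ⟨b', hb', -, hs'⟩ := mem_support_bindTimed_pure hb
    obtain ⟨a, ha, b'', hb'', -, hs''⟩ := mem_support_bindTimed hb'
    have h1 := Timed.largest_steps_le hq s.2
    have h2 := Timed.largest_length_le q s.2
    rw [Timed.charge_steps] at hs
    rw [Timed.len_steps, Timed.charge_value] at hs'
    rw [Timed.charge_value] at ha
    obtain ⟨h3, h4⟩ := steps_drawProgram_le _ _ _ _ ha
    have h5 := ih _ hb''
    rw [h4] at h5
    have h6 : m * (2 * (Timed.largest q s.2).value.length + 4 * s.2.length + 5) ≤
        m * (8 * s.2.length + 5) := Nat.mul_le_mul_left _ (by omega)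
    rw [add_mul, one_mul]
    omega

theorem steps_biCriteriaProgram_le (vs : List X) (m₀ : ℕ) {q : ℕ} (hq : 0 < q) (m t : ℕ)
    {o : Timed (List X)} (h : o ∈ (biCriteriaProgram vs m₀ q m t).support) :
    o.steps ≤ 6 * vs.length + 4 + m₀ * (6 * vs.length + 5) +
      (t - 1) * (2024 * vs.length + 123 + m * (8 * vs.length + 5)) := by
  rw [biCriteriaProgram] at h
  obtain ⟨b, hb, -, hs⟩ := mem_support_bindTimed_pure h
  obtain ⟨b', hb', -, hs'⟩ := mem_support_bindTimed_pure hb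
  obtain ⟨a, ha, b'', hb'', -, hs''⟩ := mem_support_bindTimed hb'
  obtain ⟨h3, h4⟩ := steps_drawProgram_le _ _ _ _ ha
  have h5 := steps_roundsProgram_le hq _ _ _ hb''
  rw [h4] at h5
  simp only [Timed.len_steps, Timed.mapList_steps, Timed.mapList_value, List.length_map] at *
  have h6 : 2 * vs.length + 4 * vs.length + 5 = 6 * vs.length + 5 := by ring
  rw [h6] at h3
  omega

end Implementation

/-! ### The number of centers -/

theorem length_le_of_mem_support_drawFrom {X : Type u} (Q : Finset X) (m : ℕ) (E : List X)
    {E' : List X} (h : E' ∈ (drawFrom Q m E).support) : E'.length ≤ E.length + m := by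
  induction m generalizing E with
  | zero =>
    rw [drawFrom, PMF.mem_support_pure_iff] at h
    simp [h]
  | succ m ih =>
    rw [drawFrom] at h
    split_ifs at h with hQ
    · obtain ⟨x, _, hx⟩ := (PMF.mem_support_bind_iff _ _ _).1 h
      have := ih _ hx
      rw [List.length_cons] at this
      omega
    · rw [PMF.mem_support_pure_iff] at h
      simp [h]

theorem length_le_of_mem_support_greedyRounds {X : Type u} (far : List X → Finset X) (m j : ℕ)
    (E : List X) {E' : List X} (h : E' ∈ (greedyRounds far m j E).support) :
    E'.length ≤ E.length + j * m := by
  induction j generalizing E with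
  | zero =>
    rw [greedyRounds, PMF.mem_support_pure_iff] at h
    simp [h]
  | succ j ih =>
    obtain ⟨x, hx, h⟩ := (PMF.mem_support_bind_iff _ _ _).1 h
    have h1 := length_le_of_mem_support_drawFrom _ _ _ hx
    have h2 := ih _ h
    rw [add_mul, one_mul]
    omega

theorem ncard_le_of_mem_support_biCriteria {X : Type u} [Fintype X] {z : ℕ} {ε η : ℝ} {t : ℕ}
    {far : List X → Finset X} {E : List X} (h : E ∈ (biCriteria z ε η t far).support) :
    {x | x ∈ E}.ncard ≤ initialSamples (Fintype.card X) z η + (t - 1) * roundSamples ε η := by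
  classical
  obtain ⟨E', hE', h⟩ := (PMF.mem_support_bind_iff _ _ _).1 h
  have h1 := length_le_of_mem_support_drawFrom _ _ _ hE'
  have h2 := length_le_of_mem_support_greedyRounds _ _ _ _ h
  have h3 : {x | x ∈ E}.ncard ≤ E.length := by
    rw [← List.coe_toFinset, Set.ncard_coe_finset]
    exact List.toFinset_card_le E
  rw [List.length_nil] at h1
  omega

/-! ### Bounds on the parameters -/

theorem initialSamples_le {n z : ℕ} {η γ₀ : ℝ} (hη : 0 < η) (hη1 : η < 1) (hγ₀ : γ₀ < 1)
    (h : (z : ℝ) / n ≤ γ₀) :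
    (initialSamples n z η : ℝ) ≤ 1 / (1 - γ₀) * Real.log (1 / η) + 1 := by
  have hL : 0 ≤ Real.log (1 / η) := Real.log_nonneg ((one_le_div hη).2 hη1.le)
  have h1 : 0 < 1 - (z : ℝ) / n := by linarith
  refine (Nat.ceil_lt_add_one (by positivity)).le.trans ?_
  have h2 : 1 / (1 - (z : ℝ) / n) ≤ 1 / (1 - γ₀) :=
    one_div_le_one_div_of_le (by linarith) (by linarith)
  gcongr

theorem roundSamples_le {ε ε₀ η : ℝ} (hη : 0 < η) (hη1 : η < 1) (hε : 0 < ε) (h : ε ≤ ε₀) :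
    (roundSamples ε η : ℝ) ≤ ((1 + ε₀) * Real.log (1 / η) + ε₀) / ε := by
  have hL : 0 ≤ Real.log (1 / η) := Real.log_nonneg ((one_le_div hη).2 hη1.le)
  refine (Nat.ceil_lt_add_one (by positivity)).le.trans ?_
  rw [div_mul_eq_mul_div, div_add_one hε.ne']
  gcongr

/-- The missing round absorbs the rounding up, and √κ ≤ κ because κ = 2^ρ k ≥ 1. -/
theorem doublingRounds_sub_one_le {k : ℕ} {ρ η : ℝ} (hη1 : η < 1) (hk : 0 < k) (hρ : 0 < ρ) :
    ((doublingRounds k ρ η - 1 : ℕ) : ℝ) ≤ 2 / (1 - η) * ((2 : ℝ) ^ ρ * k) := by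
  have h1 : 1 ≤ (2 : ℝ) ^ (ρ / 2) := Real.one_le_rpow one_le_two (by linarith)
  have h2 : (1 : ℝ) ≤ √k := Real.one_le_sqrt.2 (by exact_mod_cast hk)
  have h3 : (2 : ℝ) ^ ρ * k = ((2 : ℝ) ^ (ρ / 2) * √k) * ((2 : ℝ) ^ (ρ / 2) * √k) := by
    rw [mul_mul_mul_comm, ← Real.rpow_add two_pos, Real.mul_self_sqrt (by positivity),
      add_halves]
  have h4 : (2 : ℝ) ^ (ρ / 2) * √k ≤ (2 : ℝ) ^ ρ * k := by
    rw [h3]; exact le_mul_of_one_le_left (by positivity) (by nlinarith)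
  have h5 : 0 < 1 - η := by linarith
  have h6 : (doublingRounds k ρ η : ℝ) <
      ((2 : ℝ) ^ ρ * k + (2 : ℝ) ^ (ρ / 2) * √k) / (1 - η) + 1 :=
    Nat.ceil_lt_add_one (by positivity)
  have h7 : 0 < doublingRounds k ρ η := Nat.ceil_pos.2 (by positivity)
  rw [Nat.cast_sub h7]
  push_cast
  calc (doublingRounds k ρ η : ℝ) - 1
      ≤ ((2 : ℝ) ^ ρ * k + (2 : ℝ) ^ (ρ / 2) * √k) / (1 - η) := by linarith
    _ ≤ ((2 : ℝ) ^ ρ * k + (2 : ℝ) ^ ρ * k) / (1 - η) := by gcongr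
    _ = _ := by ring

theorem theorem6 (η ε₀ γ₀ : ℝ) (hη₀ : 0 < η) (hη₁ : η < 1) (hγ₀ : γ₀ < 1) :
    ∃ C : ℝ, ∀ (X : Type u) [Fintype X] [MetricSpace X] (k z : ℕ) (ε ρ : ℝ)
      (S : Finset X) (c : Fin k → X),
      0 < k → 0 < z → z < Fintype.card X → 0 < ε → 0 < ρ →
      IsOptimalSolution k z S c → DoublingDimLE S ρ →
      -- quality, for every way of breaking ties
      (∀ far : List X → Finset X, IsFarthestRule (farCount z ε) far →
        ENNReal.ofReal ((1 - η) * (1 - Real.exp (-((1 - η) / 4)))) ≤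
          (biCriteria z ε η (doublingRounds k ρ η) far).toOuterMeasure
            {E | phi z ε {x | x ∈ E} ≤ optRadius X k z}) ∧
      (ε ≤ ε₀ → (z : ℝ) / Fintype.card X ≤ γ₀ →
        -- with the same probability, a `(1, O(2^ρ / ε))`-approximation
        (∀ far : List X → Finset X, IsFarthestRule (farCount z ε) far →
          ENNReal.ofReal ((1 - η) * (1 - Real.exp (-((1 - η) / 4)))) ≤
            (biCriteria z ε η (doublingRounds k ρ η) far).toOuterMeasure
              {E | IsBicriteriaApprox k z ε 1 (C * ((2 : ℝ) ^ ρ / ε)) {x | x ∈ E}}) ∧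
        -- the program implements the algorithm in time `O(2^ρ (k / ε) n)`
        (∀ vs : List X, vs.Nodup → (∀ x, x ∈ vs) →
          (∃ far : List X → Finset X, IsFarthestRule (farCount z ε) far ∧
            (biCriteriaProgram vs (initialSamples (Fintype.card X) z η) (farCount z ε)
              (roundSamples ε η) (doublingRounds k ρ η)).map Timed.value =
              biCriteria z ε η (doublingRounds k ρ η) far) ∧
          ∀ o ∈ (biCriteriaProgram vs (initialSamples (Fintype.card X) z η) (farCount z ε)
              (roundSamples ε η) (doublingRounds k ρ η)).support,
            (o.steps : ℝ) ≤ C * ((2 : ℝ) ^ ρ * (k / ε) * Fintype.card X))) := by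
  set L := Real.log (1 / η) with hL
  have hL0 : 0 ≤ L := Real.log_nonneg ((one_le_div hη₀).2 hη₁.le)
  set N := 1 / (1 - γ₀) * L + 1 with hN
  set M := (1 + ε₀) * L + ε₀ with hM
  have hη' : 0 < 1 - η := by linarith
  have hγ' : 0 < 1 - γ₀ := by linarith
  have hN0 : 0 ≤ N := by positivity
  -- `N` bounds the initial sample and `M / ε` the sample of a round. The numbers 10 = 6 + 4, 11 = 6
  -- + 5, 2147 = 2024 + 123 and 13 = 8 + 5 arise from the step bound by `n ≥ 1`. The same constant
  -- is ample for the number of centers.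
  refine ⟨(10 + 11 * N) * ε₀ + 2 / (1 - η) * (2147 * ε₀ + 13 * M), ?_⟩
  intro X _ _ k z ε ρ S c hk hz hzn hε hρ hopt hd
  refine ⟨fun far hfar => biCriteria_quality hη₀ hη₁ hk hz hzn hε hρ hopt hd hfar, ?_⟩
  intro hεε hγ
  have hε₀ : 0 < ε₀ := hε.trans_le hεε
  have hM0 : 0 ≤ M := by positivity
  have hn : (1 : ℝ) ≤ Fintype.card X := by exact_mod_cast (by omega : 1 ≤ Fintype.card X)
  have hm₀ := initialSamples_le hη₀ hη₁ hγ₀ hγ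
  have hm := roundSamples_le hη₀ hη₁ hε hεε
  have ht := doublingRounds_sub_one_le hη₁ hk hρ
  rw [← hL, ← hN] at hm₀
  rw [← hL, ← hM] at hm
  have hκ : 1 ≤ (2 : ℝ) ^ ρ * k := by
    have h1 : 1 ≤ (2 : ℝ) ^ ρ := Real.one_le_rpow one_le_two hρ.le
    have h2 : (1 : ℝ) ≤ k := by exact_mod_cast hk
    nlinarith
  -- This charges the cost of the initial phase, free of `1 / ε` and κ, to the target bound.
  have hεκ : 1 ≤ ε₀ / ε * ((2 : ℝ) ^ ρ * k) :=
    one_le_mul_of_one_le_of_one_le ((one_le_div hε).2 hεε) hκ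
  have hε1 : 1 ≤ ε₀ / ε := (one_le_div hε).2 hεε
  have hq : 0 < farCount z ε := Nat.ceil_pos.2 (by positivity)
  refine ⟨fun far hfar => ?_, fun vs hvs hmem => ⟨⟨programFar vs (farCount z ε),
    isFarthestRule_programFar hvs hmem hq, map_value_biCriteriaProgram hvs hmem hq _⟩, ?_⟩⟩
  -- The size bound holds on the whole support, so requiring it as well costs no probability.
  · refine (biCriteria_quality hη₀ hη₁ hk hz hzn hε hρ hopt hd hfar).trans
      (PMF.toOuterMeasure_mono _ ?_)
    rintro E ⟨hE, hEs⟩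
    refine ⟨?_, by simpa using hE⟩
    have h1 : (({x | x ∈ E} : Set X).ncard : ℝ) ≤ initialSamples (Fintype.card X) z η +
        ((doublingRounds k ρ η - 1 : ℕ) : ℝ) * roundSamples ε η := by
      exact_mod_cast ncard_le_of_mem_support_biCriteria hEs
    calc (({x | x ∈ E} : Set X).ncard : ℝ)
        ≤ N + 2 / (1 - η) * ((2 : ℝ) ^ ρ * k) * (M / ε) := by
          refine h1.trans ?_
          gcongr
      _ ≤ N * (ε₀ / ε * ((2 : ℝ) ^ ρ * k)) + 2 / (1 - η) * ((2 : ℝ) ^ ρ * k) * (M / ε) := by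
          gcongr
          exact le_mul_of_one_le_right hN0 hεκ
      _ = (N * ε₀ + 2 / (1 - η) * M) * ((2 : ℝ) ^ ρ / ε) * k := by ring
      _ ≤ _ := by
          gcongr <;> nlinarith
  · intro o ho
    have hlen : vs.length = Fintype.card X := by
      classical
      rw [← List.toFinset_card_of_nodup hvs, ← Finset.card_univ]
      congr 1
      ext x; simp [hmem x]
    have h1 := steps_biCriteriaProgram_le vs _ hq _ _ ho
    rw [hlen] at h1
    have h2 : (o.steps : ℝ) ≤ 6 * Fintype.card X + 4 +
        initialSamples (Fintype.card X) z η * (6 * Fintype.card X + 5) +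
        ((doublingRounds k ρ η - 1 : ℕ) : ℝ) * (2024 * Fintype.card X + 123 +
          roundSamples ε η * (8 * Fintype.card X + 5)) := by
      exact_mod_cast h1
    generalize (Fintype.card X : ℝ) = n at *
    calc (o.steps : ℝ) ≤ (6 * n + 4 * n) + N * (6 * n + 5 * n) +
          (2 / (1 - η) * ((2 : ℝ) ^ ρ * k)) * ((2024 * n + 123 * n) +
            M / ε * (8 * n + 5 * n)) := by
          refine h2.trans ?_
          have h3 : 4 ≤ 4 * n := by linarith
          have h4 : 5 ≤ 5 * n := by linarith
          have h5 : 123 ≤ 123 * n := by linarith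
          gcongr
      _ = (10 + 11 * N) * n * 1 + (2 / (1 - η) * ((2 : ℝ) ^ ρ * k)) * (2147 * n * 1 +
            M / ε * (13 * n)) := by ring
      _ ≤ (10 + 11 * N) * n * (ε₀ / ε * ((2 : ℝ) ^ ρ * k)) +
          (2 / (1 - η) * ((2 : ℝ) ^ ρ * k)) * (2147 * n * (ε₀ / ε) + M / ε * (13 * n)) := by
          gcongr
      _ = _ := by ring
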